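/- Let $G$ be a compact metric tree: finitely many edges $e$, each identified with a compact interval $[0,|e|]$ of length $|e|>0$, whose ends are glued together at finitely many vertices so that the resulting graph is connected and has no cycles; $G$ carries its path metric. For a bounded measurable $q:G\to\mathbb{R}$ consider the Schrödinger operator $Hu=-u''+qu$ in $L^2(G)$ on the functions $u$ that are continuous on $G$, belong to $W^{2,2}(e)$ for every edge $e$, and satisfy the Kirchhoff condition at every vertex (the derivatives of $u$ along the incident edge ends, in the direction pointing into the vertex, sum to zero). Let $\lambda_1(G,q)<\lambda_2(G,q)\le\dots$ be its eigenvalues, counted with multiplicity, and let $\Gamma[q]=\lambda_2(G,q)-\lambda_1(G,q)$. For $M>0$ let $C_{G,M}$ be the set of all $q:G\to\mathbb{R}$ such that, on every path in $G$ from one leaf (vertex of degree one) to another, $q$ is convex (the path being regarded as an interval) and $0\le q\le M$. If there is an eigenfunction of the Laplacian (the case $q=0$) corresponding to $\lambda_2(G,0)$ which vanishes identically on an edge of $G$, then, for every $M>0$, the potential $q=0$ does not minimize $\Gamma$ in $C_{G,M}$; that is, there is $q\in C_{G,M}$ with $\Gamma[q]<\Gamma[0]$. -/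

import Mathlib

open Set MeasureTheory
open scoped ENNReal

noncomputable section

/-- The data of a metric graph with edge set `E`: every edge `e` is a compact interval
`[0, len e]` of positive length, and the ends of the edges (`0` and `len e`) are partitioned into
classes, the vertices. `src e` and `tgt e` are the vertices of the ends `0` and `len e` of `e`. -/
structure MetricGraph (V E : Type*) where
  src : E → V
  tgt : E → V
  len : E → ℝ
  len_pos : ∀ e, 0 < len e
  exists_incident : ∀ v, ∃ e, src e = v ∨ tgt e = v

namespace MetricGraph

variable {V E : Type*}

/-- The points of the metric graph: the edges glued at their ends, that is, the vertices together
with the interior points of the edges. -/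
inductive Point (G : MetricGraph V E) where
  | vertex (v : V) : Point G
  | interior (e : E) (s : Ioo (0 : ℝ) (G.len e)) : Point G

open Classical in
/-- `G.pt e s` is the point of `G` with coordinate `s ∈ [0, len e]` on the edge `e`
(outside of `[0, len e]` the coordinate is clamped). -/
def pt (G : MetricGraph V E) (e : E) (s : ℝ) : G.Point :=
  if h0 : s ≤ 0 then .vertex (G.src e)
  else if h1 : G.len e ≤ s then .vertex (G.tgt e)
  else .interior e ⟨s, not_le.mp h0, not_le.mp h1⟩

/-- `G.Chain x y r`: one can go from `x` to `y` by finitely many moves, each of them inside a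
single edge, of total length `r`. -/
inductive Chain (G : MetricGraph V E) : G.Point → G.Point → ℝ → Prop
  | nil (x : G.Point) : Chain G x x 0
  | cons (e : E) (s t : ℝ) (hs : s ∈ Icc 0 (G.len e)) (ht : t ∈ Icc 0 (G.len e))
      (y : G.Point) (r : ℝ) (h : Chain G (G.pt e t) y r) : Chain G (G.pt e s) y (|s - t| + r)

namespace Chain

variable {G : MetricGraph V E}

theorem nonneg {x y : G.Point} {r : ℝ} (h : G.Chain x y r) : 0 ≤ r := by
  induction h with
  | nil x => exact le_rfl
  | cons e s t hs ht y r h ih => exact add_nonneg (abs_nonneg _) ih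

theorem append {x y z : G.Point} {r r' : ℝ} (h : G.Chain x y r) (h' : G.Chain y z r') :
    G.Chain x z (r + r') := by
  induction h with
  | nil x => simpa using h'
  | cons e s t hs ht y r h ih =>
    rw [add_assoc]
    exact Chain.cons e s t hs ht z _ (ih h')

theorem symm {x y : G.Point} {r : ℝ} (h : G.Chain x y r) : G.Chain y x r := by
  induction h with
  | nil x => exact Chain.nil x
  | cons e s t hs ht y r h ih =>
    have h1 := ih.append (Chain.cons e t s ht hs _ 0 (Chain.nil _))
    rwa [add_zero, add_comm, abs_sub_comm] at h1

end Chain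

/-- The natural (path) metric of a metric graph: the infimum of the lengths of all chains
between two points (infinite if there is none). Its topology is the one used on `G.Point`. -/
instance (G : MetricGraph V E) : PseudoEMetricSpace G.Point where
  edist x y := ⨅ (r : ℝ) (_ : G.Chain x y r), ENNReal.ofReal r
  edist_self x := by
    refine le_antisymm (iInf₂_le_of_le 0 (Chain.nil x) (by simp)) bot_le
  edist_comm x y := by
    refine le_antisymm ?_ ?_ <;>
      exact le_iInf₂ fun r h => iInf₂_le r h.symm
  edist_triangle x y z := by
    refine ENNReal.le_of_forall_pos_le_add fun ε hε hfin => ?_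
    have hx : (⨅ (r : ℝ) (_ : G.Chain x y r), ENNReal.ofReal r) ≠ ⊤ :=
      (ENNReal.add_lt_top.mp hfin).1.ne
    have hy : (⨅ (r : ℝ) (_ : G.Chain y z r), ENNReal.ofReal r) ≠ ⊤ :=
      (ENNReal.add_lt_top.mp hfin).2.ne
    have hε2 : ((ε / 2 : NNReal) : ℝ≥0∞) ≠ 0 := by
      simpa using hε.ne'
    have h1 := ENNReal.lt_add_right hx hε2
    have h2 := ENNReal.lt_add_right hy hε2
    simp only [iInf_lt_iff] at h1 h2
    obtain ⟨r, hr, hr'⟩ := h1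
    obtain ⟨s, hs, hs'⟩ := h2
    refine (iInf₂_le (r + s) (hr.append hs)).trans ?_
    rw [ENNReal.ofReal_add hr.nonneg hs.nonneg]
    refine (add_le_add hr'.le hs'.le).trans (le_of_eq ?_)
    have : (ε : ℝ≥0∞) = ((ε / 2 : NNReal) : ℝ≥0∞) + ((ε / 2 : NNReal) : ℝ≥0∞) := by
      rw [← ENNReal.coe_add, add_halves]
    rw [this]
    ring

/-- Adjacency of distinct vertices. -/
def toSimpleGraph (G : MetricGraph V E) : SimpleGraph V :=
  SimpleGraph.fromRel fun v w => ∃ e, G.src e = v ∧ G.tgt e = w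

/-- A tree: connected and without cycles (no loops, no parallel edges and no longer cycles). -/
def IsTree (G : MetricGraph V E) : Prop :=
  (∀ e, G.src e ≠ G.tgt e) ∧
  (∀ e e', s(G.src e, G.tgt e) = s(G.src e', G.tgt e') → e = e') ∧
  G.toSimpleGraph.IsTree

open Classical in
/-- The degree of a vertex: the number of edge ends at it. -/
def degree [Fintype E] (G : MetricGraph V E) (v : V) : ℕ :=
  (Finset.univ.filter fun e => G.src e = v).card + (Finset.univ.filter fun e => G.tgt e = v).card

/-- A leaf (boundary vertex) is a vertex of degree one. -/
def IsLeaf [Fintype E] (G : MetricGraph V E) (v : V) : Prop := G.degree v = 1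

/-- `f` is (the continuous representative of) an element of the Sobolev space `W^{1,2}(0, ℓ)`,
with derivative `g ∈ L²(0, ℓ)`. -/
def HasSobolevDeriv (ℓ : ℝ) (f g : ℝ → ℝ) : Prop :=
  MemLp g 2 (volume.restrict (Ioo 0 ℓ)) ∧
  ∀ x ∈ Icc (0 : ℝ) ℓ, f x = f 0 + ∫ t in (0 : ℝ)..x, g t

open Classical in
/-- The sum over all edge ends at the vertex `v` of the derivative in the direction pointing into
`v`, where `du e` is the derivative along the edge `e`. -/
def normalDerivSum [Fintype E] (G : MetricGraph V E) (du : E → ℝ → ℝ) (v : V) : ℝ :=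
  ∑ e, ((if G.src e = v then -du e 0 else 0) + (if G.tgt e = v then du e (G.len e) else 0))

/-- `u` is an eigenfunction of the Schrödinger operator `H u = -u'' + q u` with eigenvalue `μ`:
`u` is nonzero and in the domain of `H`, that is, continuous on `G`, in `W^{2,2}` of every edge and
satisfying the Kirchhoff condition at every vertex, and `-u'' + q u = μ u` almost everywhere. -/
def IsEigenfunction [Fintype E] (G : MetricGraph V E) (q : G.Point → ℝ) (μ : ℝ)
    (u : G.Point → ℝ) : Prop :=
  u ≠ 0 ∧ Continuous u ∧
  ∃ du ddu : E → ℝ → ℝ,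
    (∀ e, HasSobolevDeriv (G.len e) (fun s => u (G.pt e s)) (du e)) ∧
    (∀ e, HasSobolevDeriv (G.len e) (du e) (ddu e)) ∧
    (∀ v, G.normalDerivSum du v = 0) ∧
    (∀ e, ∀ᵐ s ∂(volume.restrict (Ioo 0 (G.len e))),
      -ddu e s + q (G.pt e s) * u (G.pt e s) = μ * u (G.pt e s))

/-- The `k`-th eigenvalue `λ_k(G, q)` (`k ≥ 1`) in increasing order and counted with multiplicity:
the least `μ` such that there are `k` linearly independent eigenfunctions with eigenvalues at
most `μ`. -/
def eigenvalue [Fintype E] (G : MetricGraph V E) (q : G.Point → ℝ) (k : ℕ) : ℝ :=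
  sInf {μ : ℝ | ∃ u : Fin k → G.Point → ℝ, LinearIndependent ℝ u ∧
    ∀ i, ∃ ν ≤ μ, G.IsEigenfunction q ν (u i)}

/-- The fundamental gap `Γ[q] = λ₂(q) - λ₁(q)`. -/
def gap [Fintype E] (G : MetricGraph V E) (q : G.Point → ℝ) : ℝ :=
  G.eigenvalue q 2 - G.eigenvalue q 1

/-- `P` is a path from `x` to `y`: the image of a continuous injective curve from `x` to `y`. -/
def IsPath (G : MetricGraph V E) (x y : G.Point) (P : Set G.Point) : Prop :=
  ∃ γ : ℝ → G.Point, ContinuousOn γ (Icc 0 1) ∧ InjOn γ (Icc 0 1) ∧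
    γ 0 = x ∧ γ 1 = y ∧ γ '' Icc 0 1 = P

/-- `q` is convex on the path `P`, regarded as an interval: it is convex in the coordinate given
by an isometry of an interval `[0, L]` onto `P`. (In a tree every path is isometric to an interval,
its arc length parametrization being an isometry.) -/
def ConvexOnPath (G : MetricGraph V E) (q : G.Point → ℝ) (P : Set G.Point) : Prop :=
  ∀ (L : ℝ) (c : ℝ → G.Point), Isometry ((Icc 0 L).domRestrict c) → c '' Icc 0 L = P →
    ConvexOn ℝ (Icc 0 L) (q ∘ c)

/-- The class `C_{G,M}` of a tree `G`: the potentials that are convex on, and take values in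
`[0, M]` on, every path from a boundary vertex to another one. -/
def convexClass [Fintype E] (G : MetricGraph V E) (M : ℝ) : Set (G.Point → ℝ) :=
  {q | ∀ v w, G.IsLeaf v → G.IsLeaf w → v ≠ w → ∀ P, G.IsPath (.vertex v) (.vertex w) P →
    G.ConvexOnPath q P ∧ ∀ x ∈ P, 0 ≤ q x ∧ q x ≤ M}

end MetricGraph

end

noncomputable section

open Filter Topology
open scoped BoundedContinuousFunction

namespace MetricGraph

variable {V E : Type*} {G : MetricGraph V E}

/-! ### Points and the path metric -/

/-! The competitor is a small potential supported on a boundary edge where some eigenfunction for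
`λ₂(G, 0)` vanishes. That eigenfunction does not feel the potential and keeps its eigenvalue,
whereas the ground state is positive everywhere, so the lowest eigenvalue rises strictly above `0`.
Hence the gap shrinks.

The given edge `f` may be interior. Since `u` and `u'` vanish on `f`, erasing `u` on one side of `f`
leaves a solution. One of the two erasures is nonzero, and the erased side contains a boundary edge
(`exists_isSolution_boundaryEdge`). On that edge the potential falls affinely from `t` at the leaf
to `0`. Along a leaf-to-leaf path it is either zero or the positive part of an affine function,
hence convex (`boundaryPotential_mem_convexClass`).

Spectral theory is avoided. For arbitrarily small `t > 0`, a positive solution near the constant `1`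
comes from a surjective linearization in a Banach space (`exists_pos_isSolution`). Picone's identity
shows that its eigenvalue `μ` is the lowest one (`le_of_pos`), and integrating the equation over the
tree gives `μ > 0` (`eigenvalue_pos`). For the second eigenvalue only the upper bound
`eigenvalue_two_le` is needed. -/

theorem pt_zero (e : E) : G.pt e 0 = .vertex (G.src e) := by simp [pt]

theorem pt_len (e : E) : G.pt e (G.len e) = .vertex (G.tgt e) := by
  simp [pt, not_le.mpr (G.len_pos e)]

theorem pt_coe (e : E) (s : Ioo (0 : ℝ) (G.len e)) : G.pt e s = .interior e s := by
  simp [pt, not_le.mpr s.2.1, not_le.mpr s.2.2]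

theorem zero_mem (e : E) : (0 : ℝ) ∈ Icc 0 (G.len e) := ⟨le_rfl, (G.len_pos e).le⟩

theorem len_mem (e : E) : G.len e ∈ Icc 0 (G.len e) := ⟨(G.len_pos e).le, le_rfl⟩

theorem exists_pt_eq (x : G.Point) : ∃ e, ∃ s ∈ Icc 0 (G.len e), G.pt e s = x := by
  cases x with
  | vertex v =>
    obtain ⟨e, rfl | rfl⟩ := G.exists_incident v
    · exact ⟨e, 0, zero_mem e, pt_zero e⟩
    · exact ⟨e, G.len e, len_mem e, pt_len e⟩
  | interior e s => exact ⟨e, s, Ioo_subset_Icc_self s.2, pt_coe e s⟩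

theorem finite_vertices [Finite E] (G : MetricGraph V E) : Finite V := by
  have : Finite (E ⊕ E) := inferInstance
  refine Finite.of_surjective (Sum.elim G.src G.tgt) fun v => ?_
  obtain ⟨e, h | h⟩ := G.exists_incident v
  · exact ⟨.inl e, h⟩
  · exact ⟨.inr e, h⟩

theorem edist_pt_le {e : E} {s t : ℝ} (hs : s ∈ Icc 0 (G.len e)) (ht : t ∈ Icc 0 (G.len e)) :
    edist (G.pt e s) (G.pt e t) ≤ ENNReal.ofReal |s - t| :=
  iInf₂_le |s - t| (by simpa using Chain.cons e s t hs ht _ 0 (Chain.nil (G.pt e t)))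

/-- Increments along a chain add up to at most its length. Lower bounds for the path metric, an
infimum over chains, are obtained from such test functions. -/
theorem Chain.abs_sub_le {h : G.Point → ℝ}
    (H : ∀ e, ∀ s ∈ Icc 0 (G.len e), ∀ t ∈ Icc 0 (G.len e),
      |h (G.pt e s) - h (G.pt e t)| ≤ |s - t|)
    {x y : G.Point} {r : ℝ} (hr : G.Chain x y r) : |h x - h y| ≤ r := by
  induction hr with
  | nil x => simp
  | cons e s t hs ht y r _ ih =>
    exact (_root_.abs_sub_le _ (h (G.pt e t)) _).trans (add_le_add (H e s hs t ht) ih)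

/-- A function that is `1`-Lipschitz along every edge is `1`-Lipschitz. -/
theorem ofReal_abs_sub_le_edist {h : G.Point → ℝ}
    (H : ∀ e, ∀ s ∈ Icc 0 (G.len e), ∀ t ∈ Icc 0 (G.len e),
      |h (G.pt e s) - h (G.pt e t)| ≤ |s - t|) (x y : G.Point) :
    ENNReal.ofReal |h x - h y| ≤ edist x y :=
  le_iInf₂ fun _ hr => ENNReal.ofReal_le_ofReal (hr.abs_sub_le H)

theorem continuousOn_pt (e : E) : ContinuousOn (G.pt e) (Icc 0 (G.len e)) := by
  have : LipschitzOnWith 1 (G.pt e) (Icc 0 (G.len e)) := by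
    intro s hs t ht
    rw [ENNReal.coe_one, one_mul, edist_dist, Real.dist_eq]
    exact edist_pt_le hs ht
  exact this.continuousOn

/-- The function on the graph with values `b` at the vertices and `F e` on the edge `e`. -/
def glue (b : V → ℝ) (F : E → ℝ → ℝ) : G.Point → ℝ
  | .vertex v => b v
  | .interior e s => F e s

theorem glue_pt {b : V → ℝ} {F : E → ℝ → ℝ} {e : E} (h0 : F e 0 = b (G.src e))
    (h1 : F e (G.len e) = b (G.tgt e)) {s : ℝ} (hs : s ∈ Icc 0 (G.len e)) :
    glue b F (G.pt e s) = F e s := by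
  rcases hs.1.eq_or_lt with rfl | h
  · rw [pt_zero, h0, glue]
  rcases hs.2.eq_or_lt with rfl | h'
  · rw [pt_len, h1, glue]
  · have := pt_coe e ⟨s, h, h'⟩
    simp only at this
    rw [this, glue]

open Classical in
/-- The distance to the vertex `v`, truncated at `ρ`, where `ρ` is at most the length of every edge
at `v`. -/
def vdist (G : MetricGraph V E) (v : V) (ρ : ℝ) : G.Point → ℝ :=
  glue (fun w => if w = v then 0 else ρ) fun e s =>
    min ρ (min (if G.src e = v then s else ρ) (if G.tgt e = v then G.len e - s else ρ))

section vdist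

variable {v : V} {ρ : ℝ}

open Classical in
-- As `ρ` does not exceed the length of any edge at `v`, the formula on an edge has reached `ρ` at
-- an end other than `v`, matching the vertex value there.
theorem vdist_pt (hρ : 0 < ρ) (hv : ∀ e, G.src e = v ∨ G.tgt e = v → ρ ≤ G.len e)
    (e : E) {s : ℝ} (hs : s ∈ Icc 0 (G.len e)) :
    G.vdist v ρ (G.pt e s) =
      min ρ (min (if G.src e = v then s else ρ) (if G.tgt e = v then G.len e - s else ρ)) := by
  refine glue_pt ?_ ?_ hs
  · have := hv e
    have := G.len_pos e
    grind
  · have := hv e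
    have := G.len_pos e
    grind

theorem vdist_vertex_self : G.vdist v ρ (.vertex v) = 0 := by simp [vdist, glue]

theorem vdist_vertex_of_ne {w : V} (h : w ≠ v) : G.vdist v ρ (.vertex w) = ρ := by
  simp [vdist, glue, h]

theorem vdist_abs_sub_le (hρ : 0 < ρ) (hv : ∀ e, G.src e = v ∨ G.tgt e = v → ρ ≤ G.len e)
    (e : E) (s : ℝ) (hs : s ∈ Icc 0 (G.len e)) (t : ℝ) (ht : t ∈ Icc 0 (G.len e)) :
    |G.vdist v ρ (G.pt e s) - G.vdist v ρ (G.pt e t)| ≤ |s - t| := by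
  classical
  rw [vdist_pt hρ hv e hs, vdist_pt hρ hv e ht]
  refine (abs_min_sub_min_le_max _ _ _ _).trans (max_le (by simp) ?_)
  refine (abs_min_sub_min_le_max _ _ _ _).trans (max_le ?_ ?_)
  · split_ifs <;> simp
  · split_ifs
    · rw [show G.len e - s - (G.len e - t) = -(s - t) by ring, abs_neg]
    · simp

theorem vdist_nonneg (hρ : 0 < ρ) (hv : ∀ e, G.src e = v ∨ G.tgt e = v → ρ ≤ G.len e)
    (x : G.Point) : 0 ≤ G.vdist v ρ x := by
  classical
  obtain ⟨e, s, hs, rfl⟩ := exists_pt_eq x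
  rw [vdist_pt hρ hv e hs]
  refine le_min hρ.le (le_min ?_ ?_) <;> split_ifs <;> linarith [hs.1, hs.2]

theorem vdist_le (hρ : 0 < ρ) (hv : ∀ e, G.src e = v ∨ G.tgt e = v → ρ ≤ G.len e)
    (x : G.Point) : G.vdist v ρ x ≤ ρ := by
  classical
  obtain ⟨e, s, hs, rfl⟩ := exists_pt_eq x
  rw [vdist_pt hρ hv e hs]
  exact min_le_left _ _

/-- The points close to `v` lie on the edges at `v`. -/
theorem eq_pt_of_vdist_lt (hρ : 0 < ρ) (hv : ∀ e, G.src e = v ∨ G.tgt e = v → ρ ≤ G.len e)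
    {x : G.Point} (hx : G.vdist v ρ x < ρ) :
    ∃ e, (G.src e = v ∧ x = G.pt e (G.vdist v ρ x)) ∨
      (G.tgt e = v ∧ x = G.pt e (G.len e - G.vdist v ρ x)) := by
  classical
  obtain ⟨e, s, hs, rfl⟩ := exists_pt_eq x
  refine ⟨e, ?_⟩
  rw [vdist_pt hρ hv e hs] at hx ⊢
  have h := (min_lt_iff.mp hx).resolve_left (lt_irrefl _)
  rw [min_eq_right h.le]
  rcases le_total (if G.src e = v then s else ρ) (if G.tgt e = v then G.len e - s else ρ)
    with h' | h'
  · rw [min_eq_left h'] at h ⊢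
    split_ifs at h ⊢ with h1
    · exact .inl ⟨h1, rfl⟩
    · exact absurd h (lt_irrefl _)
  · rw [min_eq_right h'] at h ⊢
    split_ifs at h ⊢ with h1
    · exact .inr ⟨h1, by rw [sub_sub_cancel]⟩
    · exact absurd h (lt_irrefl _)

theorem continuous_vdist (hρ : 0 < ρ) (hv : ∀ e, G.src e = v ∨ G.tgt e = v → ρ ≤ G.len e) :
    Continuous (G.vdist v ρ) := by
  have : LipschitzWith 1 (G.vdist v ρ) := by
    intro x y
    rw [ENNReal.coe_one, one_mul, edist_dist, Real.dist_eq]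
    exact ofReal_abs_sub_le_edist (vdist_abs_sub_le hρ hv) x y
  exact this.continuous

end vdist

theorem exists_pos_forall_le {ι : Type*} [Finite ι] (f : ι → ℝ) (hf : ∀ i, 0 < f i) :
    ∃ δ > 0, ∀ i, δ ≤ f i := by
  rcases isEmpty_or_nonempty ι with h | h
  · exact ⟨1, one_pos, fun i => isEmptyElim i⟩
  · obtain ⟨i, hi⟩ := Finite.exists_min f
    exact ⟨f i, hf i, hi⟩

/-- A function is continuous on the graph if it is continuous on every closed edge. -/
theorem continuous_of_continuousOn_edges [Finite E] {f : G.Point → ℝ}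
    (hf : ∀ e, ContinuousOn (fun s => f (G.pt e s)) (Icc 0 (G.len e))) : Continuous f := by
  classical
  rw [continuous_iff_continuousAt]
  intro x
  refine Metric.tendsto_nhds.mpr fun ε hε => ?_
  simp only [Real.dist_eq]
  have ball : ∀ δ > 0, ∀ᶠ y in 𝓝 x, edist y x < ENNReal.ofReal δ := fun δ hδ =>
    (tendsto_iff_edist_tendsto_0.mp (tendsto_id (x := 𝓝 x))).eventually_lt_const (by simpa using hδ)
  have close : ∀ e, ∀ s ∈ Icc 0 (G.len e), ∃ δ > 0, ∀ t ∈ Icc 0 (G.len e), |t - s| < δ →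
      |f (G.pt e t) - f (G.pt e s)| < ε := by
    intro e s hs
    obtain ⟨δ, hδ, h⟩ := Metric.continuousWithinAt_iff.mp (hf e s hs) ε hε
    exact ⟨δ, hδ, fun t ht hts => h ht hts⟩
  cases x with
  | vertex v =>
    -- Near a vertex the truncated distance `vdist` is the test function: a point closer than `ρ`
    -- lies on an edge at `v`, at that coordinate distance from its end.
    obtain ⟨ρ, hρ, hρ'⟩ := exists_pos_forall_le G.len G.len_pos
    have hv : ∀ e, G.src e = v ∨ G.tgt e = v → ρ ≤ G.len e := fun e _ => hρ' e
    choose δ₀ h₀ H₀ using fun e => close e 0 (zero_mem e)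
    choose δ₁ h₁ H₁ using fun e => close e (G.len e) (len_mem e)
    obtain ⟨δ, hδ, hδ'⟩ := exists_pos_forall_le (fun e => min (δ₀ e) (δ₁ e))
      fun e => lt_min (h₀ e) (h₁ e)
    filter_upwards [ball (min ρ δ) (lt_min hρ hδ)] with y hy
    have h1 := (ofReal_abs_sub_le_edist (vdist_abs_sub_le hρ hv) y _).trans_lt hy
    have h0 := vdist_nonneg hρ hv y
    rw [vdist_vertex_self, sub_zero, abs_of_nonneg h0,
      ENNReal.ofReal_lt_ofReal_iff (lt_min hρ hδ), lt_min_iff] at h1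
    obtain ⟨e, ⟨rfl, h⟩ | ⟨rfl, h⟩⟩ := eq_pt_of_vdist_lt hρ hv h1.1
    · have := H₀ e (G.vdist (G.src e) ρ y) ⟨h0, by linarith [hρ' e]⟩
        (by rw [sub_zero, abs_of_nonneg h0]; exact h1.2.trans_le ((hδ' e).trans (min_le_left _ _)))
      rwa [← h, pt_zero] at this
    · have := H₁ e (G.len e - G.vdist (G.tgt e) ρ y) ⟨by linarith [hρ' e], by linarith⟩
        (by
          rw [sub_sub_cancel_left, abs_neg, abs_of_nonneg h0]
          exact h1.2.trans_le ((hδ' e).trans (min_le_right _ _)))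
      rwa [← h, pt_len] at this
  | interior e s =>
    obtain ⟨s, hs⟩ := s
    obtain ⟨δ, hδ, H⟩ := close e s (Ioo_subset_Icc_self hs)
    set ρ := min s (G.len e - s) with hρdef
    have hρ : 0 < ρ := lt_min hs.1 (sub_pos.mpr hs.2)
    -- Near an interior point the test function is the coordinate distance along `e`, cut off at the
    -- distance `ρ` to the nearer end; it stays at `ρ` off `e`.
    let F : E → ℝ → ℝ := fun e' s' => if e' = e then min ρ |s' - s| else ρ
    have hF : ∀ e', ∀ s' ∈ Icc 0 (G.len e'),
        glue (fun _ => ρ) F (G.pt e' s') = F e' s' := by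
      intro e' s' hs'
      refine glue_pt ?_ ?_ hs'
      · by_cases h : e' = e
        · simp only [F, h, if_true, zero_sub, abs_neg, abs_of_pos hs.1]
          exact min_eq_left (min_le_left _ _)
        · simp [F, h]
      · by_cases h : e' = e
        · subst h
          simp only [F, if_true, abs_of_pos (sub_pos.mpr hs.2)]
          exact min_eq_left (min_le_right _ _)
        · simp [F, h]
    have hlip : ∀ e', ∀ a ∈ Icc 0 (G.len e'), ∀ b ∈ Icc 0 (G.len e'),
        |glue (fun _ => ρ) F (G.pt e' a) - glue (fun _ => ρ) F (G.pt e' b)| ≤ |a - b| := by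
      intro e' a ha b hb
      rw [hF e' a ha, hF e' b hb]
      by_cases h : e' = e
      · simp only [F, h, if_true]
        refine (abs_min_sub_min_le_max _ _ _ _).trans (max_le (by simp) ?_)
        refine (abs_abs_sub_abs_le_abs_sub _ _).trans (by simp)
      · simp [F, h]
    filter_upwards [ball (min ρ δ) (lt_min hρ hδ)] with y hy
    have h1 := (ofReal_abs_sub_le_edist hlip y _).trans_lt hy
    have hx : glue (fun _ => ρ) F (Point.interior (G := G) e ⟨s, hs⟩) = 0 := by
      simp [glue, F, hρ.le]
    rw [hx, sub_zero, ENNReal.ofReal_lt_ofReal_iff (lt_min hρ hδ), lt_min_iff] at h1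
    cases y with
    | vertex w => simp [glue, abs_of_pos hρ] at h1
    | interior e' s' =>
      by_cases h : e' = e
      · subst h
        obtain ⟨s', hs'⟩ := s'
        simp only [glue, F, if_true] at h1
        rw [abs_of_nonneg (le_min hρ.le (abs_nonneg _))] at h1
        have h2 := (min_lt_iff.mp h1.1).resolve_left (lt_irrefl _)
        rw [min_eq_right h2.le] at h1
        have := H s' (Ioo_subset_Icc_self hs') h1.2
        rwa [pt_coe e' ⟨s', hs'⟩, pt_coe e' ⟨s, hs⟩] at this
      · simp [glue, F, h, abs_of_pos hρ] at h1

/-! ### Potentials supported on a boundary edge -/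

theorem edist_vertex_le_vdist {v : V} {ρ : ℝ} (hρ : 0 < ρ)
    (hv : ∀ e, G.src e = v ∨ G.tgt e = v → ρ ≤ G.len e) {x : G.Point} (hx : G.vdist v ρ x < ρ) :
    edist x (.vertex v) ≤ ENNReal.ofReal (G.vdist v ρ x) := by
  have h0 := vdist_nonneg hρ hv x
  obtain ⟨e, ⟨h, h'⟩ | ⟨h, h'⟩⟩ := eq_pt_of_vdist_lt hρ hv hx
  · have hle := hv e (.inl h)
    have := edist_pt_le (G := G) (e := e) (s := G.vdist v ρ x) (t := 0) ⟨h0, by linarith⟩ (zero_mem e)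
    rwa [← h', pt_zero, h, sub_zero, abs_of_nonneg h0] at this
  · have hle := hv e (.inr h)
    have := edist_pt_le (G := G) (e := e) (s := G.len e - G.vdist v ρ x) (t := G.len e)
      ⟨by linarith, by linarith⟩ (len_mem e)
    rwa [← h', pt_len, h, sub_sub_cancel_left, abs_neg, abs_of_nonneg h0] at this

/-- `w` is an end of the edge `f` and of no other edge. -/
def IsBoundaryEdge (G : MetricGraph V E) (w : V) (f : E) : Prop :=
  ∀ e, G.src e = w ∨ G.tgt e = w ↔ e = f

/-- The potential that is affine on the edge `f` at the boundary vertex `w`, where it takes the value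
`t`, and zero on the other edges. -/
def boundaryPotential (G : MetricGraph V E) (w : V) (f : E) (t : ℝ) (x : G.Point) : ℝ :=
  t * (1 - G.vdist w (G.len f) x / G.len f)

namespace IsBoundaryEdge

variable {w : V} {f : E}

theorem len_le (hf : G.IsBoundaryEdge w f) (e : E) (he : G.src e = w ∨ G.tgt e = w) :
    G.len f ≤ G.len e := by
  rw [(hf e).mp he]

/-- Only `f` ends at `w`, and only with one of its ends, so a distance less than `len f` from `w`
determines the point. -/
theorem eq_of_vdist_eq (hf : G.IsBoundaryEdge w f) (hloop : ∀ e, G.src e ≠ G.tgt e)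
    {x y : G.Point} (hx : G.vdist w (G.len f) x < G.len f)
    (hxy : G.vdist w (G.len f) x = G.vdist w (G.len f) y) : x = y := by
  obtain ⟨e, h⟩ := eq_pt_of_vdist_lt (G.len_pos f) hf.len_le hx
  obtain ⟨e', h'⟩ := eq_pt_of_vdist_lt (G.len_pos f) hf.len_le (hxy ▸ hx)
  have he : e = f := (hf e).mp (h.imp And.left And.left)
  have he' : e' = f := (hf e').mp (h'.imp And.left And.left)
  subst he he'
  rcases h with ⟨h1, h⟩ | ⟨h1, h⟩ <;> rcases h' with ⟨h2, h'⟩ | ⟨h2, h'⟩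
  · rw [h, h', hxy]
  · exact absurd (h1.trans h2.symm) (hloop _)
  · exact absurd (h2.trans h1.symm) (hloop _)
  · rw [h, h', hxy]

/-- The Lipschitz test function bounds the metric from below, and walking along `f` bounds it from
above. This expresses the potential in arc length along any path ending at `w`. -/
theorem vdist_eq_min (hf : G.IsBoundaryEdge w f) {r : ℝ} {x : G.Point} (hr : 0 ≤ r)
    (hx : edist x (.vertex w) = ENNReal.ofReal r) : G.vdist w (G.len f) x = min (G.len f) r := by
  have hρ := G.len_pos f
  have h0 := vdist_nonneg hρ hf.len_le x
  have h1 := ofReal_abs_sub_le_edist (vdist_abs_sub_le hρ hf.len_le) x (.vertex w)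
  rw [vdist_vertex_self, sub_zero, abs_of_nonneg h0, hx, ENNReal.ofReal_le_ofReal_iff hr] at h1
  refine le_antisymm (le_min (vdist_le hρ hf.len_le x) h1) ?_
  rcases (vdist_le hρ hf.len_le x).eq_or_lt with h | h
  · exact (min_le_left _ _).trans h.ge
  · have h2 := edist_vertex_le_vdist hρ hf.len_le h
    rw [hx, ENNReal.ofReal_le_ofReal_iff h0] at h2
    exact (min_le_right _ _).trans h2

/-- A path between vertices other than `w` that does not contain `w` does not meet the edge
at `w`. -/
theorem vdist_eq_of_isPath (hf : G.IsBoundaryEdge w f) (hloop : ∀ e, G.src e ≠ G.tgt e)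
    {a b : V} {P : Set G.Point} (hP : G.IsPath (.vertex a) (.vertex b) P)
    (hw : .vertex w ∉ P) {x : G.Point} (hx : x ∈ P) : G.vdist w (G.len f) x = G.len f := by
  obtain ⟨γ, hγ, hinj, h0, h1, rfl⟩ := hP
  have ha : a ≠ w := fun h => hw ⟨0, by simp, by rw [h0, h]⟩
  have hb : b ≠ w := fun h => hw ⟨1, by simp, by rw [h1, h]⟩
  obtain ⟨τ, hτ, rfl⟩ := hx
  have hρ := G.len_pos f
  by_contra hne
  have hlt := (vdist_le hρ hf.len_le (γ τ)).lt_of_ne hne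
  have hcont : ContinuousOn (fun τ => G.vdist w (G.len f) (γ τ)) (Icc 0 1) :=
    (continuous_vdist hρ hf.len_le).comp_continuousOn hγ
  obtain ⟨r, hr, hr'⟩ := exists_between hlt
  have h0' : G.vdist w (G.len f) (γ 0) = G.len f := by rw [h0, vdist_vertex_of_ne ha]
  have h1' : G.vdist w (G.len f) (γ 1) = G.len f := by rw [h1, vdist_vertex_of_ne hb]
  -- A path entering `f` from its far end without reaching `w` must come back: level `r` is attained
  -- both before and after `τ`, at the same point of `f`, against injectivity.
  obtain ⟨τ₁, hτ₁, h₁⟩ := intermediate_value_Icc' hτ.1 (hcont.mono (Icc_subset_Icc le_rfl hτ.2))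
    (show r ∈ _ from ⟨hr.le, by simp only [h0']; exact hr'.le⟩)
  obtain ⟨τ₂, hτ₂, h₂⟩ := intermediate_value_Icc hτ.2 (hcont.mono (Icc_subset_Icc hτ.1 le_rfl))
    (show r ∈ _ from ⟨hr.le, by simp only [h1']; exact hr'.le⟩)
  simp only at h₁ h₂
  have heq : γ τ₁ = γ τ₂ := hf.eq_of_vdist_eq hloop (h₁ ▸ hr') (h₁.trans h₂.symm)
  have := hinj ⟨hτ₁.1, hτ₁.2.trans hτ.2⟩ ⟨hτ.1.trans hτ₂.1, hτ₂.2⟩ heq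
  have : τ₁ = τ := le_antisymm hτ₁.2 (this ▸ hτ₂.1)
  rw [this] at h₁
  exact hr.ne h₁

theorem boundaryPotential_mem_Icc (hf : G.IsBoundaryEdge w f) {t : ℝ} (ht : 0 ≤ t)
    (x : G.Point) : G.boundaryPotential w f t x ∈ Icc 0 t := by
  have hρ := G.len_pos f
  have h0 : 0 ≤ G.vdist w (G.len f) x / G.len f :=
    div_nonneg (vdist_nonneg hρ hf.len_le x) hρ.le
  have h1 : G.vdist w (G.len f) x / G.len f ≤ 1 :=
    (div_le_one hρ).mpr (vdist_le hρ hf.len_le x)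
  exact ⟨mul_nonneg ht (by linarith), mul_le_of_le_one_right ht (by linarith)⟩

theorem boundaryPotential_mem_convexClass [Fintype E] (hf : G.IsBoundaryEdge w f)
    (hloop : ∀ e, G.src e ≠ G.tgt e) {t M : ℝ} (ht : 0 ≤ t) (htM : t ≤ M) :
    G.boundaryPotential w f t ∈ G.convexClass M := by
  intro a b _ _ _ P hP
  have hρ := G.len_pos f
  refine ⟨fun L c hc hcP => ?_, fun x _ => ?_⟩
  swap
  · have := hf.boundaryPotential_mem_Icc ht x
    exact ⟨this.1, this.2.trans htM⟩
  by_cases hw : Point.vertex w ∈ P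
  · obtain ⟨s₀, hs₀, hcs₀⟩ : Point.vertex w ∈ c '' Icc 0 L := hcP ▸ hw
    have hdist : ∀ s ∈ Icc 0 L, G.vdist w (G.len f) (c s) = min (G.len f) |s - s₀| := by
      intro s hs
      refine hf.vdist_eq_min (abs_nonneg _) ?_
      have := hc ⟨s, hs⟩ ⟨s₀, hs₀⟩
      rw [← hcs₀]
      rwa [Subtype.edist_mk_mk, edist_dist, Real.dist_eq] at this
    -- A leaf cannot be interior to the path: the points at distance `ε` on either side of it would
    -- coincide.
    have hend : s₀ = 0 ∨ s₀ = L := by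
      by_contra! h
      have hpos : 0 < s₀ := hs₀.1.lt_of_ne h.1.symm
      have hlt : s₀ < L := hs₀.2.lt_of_ne h.2
      obtain ⟨ε, hε, hε'⟩ := exists_between (lt_min (lt_min hpos (sub_pos.mpr hlt)) hρ)
      simp only [lt_min_iff] at hε'
      have m1 : s₀ - ε ∈ Icc 0 L := ⟨by linarith, by linarith⟩
      have m2 : s₀ + ε ∈ Icc 0 L := ⟨by linarith, by linarith⟩
      have d1 := hdist _ m1
      have d2 := hdist _ m2
      rw [sub_sub_cancel_left, abs_neg, abs_of_pos hε, min_eq_right hε'.2.le] at d1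
      rw [add_sub_cancel_left, abs_of_pos hε, min_eq_right hε'.2.le] at d2
      have heq : c (s₀ - ε) = c (s₀ + ε) :=
        hf.eq_of_vdist_eq hloop (d1.trans_lt hε'.2) (d1.trans d2.symm)
      have := hc ⟨s₀ - ε, m1⟩ ⟨s₀ + ε, m2⟩
      simp only [Set.domRestrict, heq, edist_self] at this
      have := congrArg Subtype.val (edist_eq_zero.mp this.symm)
      simp only at this
      linarith
    obtain ⟨α, β, hαβ⟩ : ∃ α β : ℝ, ∀ s ∈ Icc 0 L, |s - s₀| = α * s + β := by
      rcases hend with rfl | rfl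
      · exact ⟨1, 0, fun s hs => by rw [sub_zero, abs_of_nonneg hs.1]; ring⟩
      · exact ⟨-1, s₀, fun s hs => by rw [abs_of_nonpos (by linarith [hs.2])]; ring⟩
    have hconv : ConvexOn ℝ (Icc 0 L) fun s : ℝ =>
        t * (max 0 (1 - (α * s + β) / G.len f)) := by
      refine ConvexOn.smul ht (ConvexOn.sup (convexOn_const _ (convex_Icc _ _)) ?_)
      refine ⟨convex_Icc _ _, fun x _ y _ p r _ _ hpr => le_of_eq ?_⟩
      have : p = 1 - r := by linarith
      subst this
      simp only [smul_eq_mul]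
      ring
    refine hconv.congr fun s hs => ?_
    simp only [Function.comp_apply, boundaryPotential, hdist s hs, hαβ s hs]
    congr 1
    rcases le_total (G.len f) (α * s + β) with h | h
    · rw [min_eq_left h, div_self hρ.ne', sub_self, max_eq_left]
      rw [sub_nonpos, le_div_iff₀ hρ]
      linarith
    · rw [min_eq_right h, max_eq_right]
      rw [sub_nonneg, div_le_one hρ]
      exact h
  · refine (convexOn_const 0 (convex_Icc _ _)).congr fun s hs => ?_
    have := hf.vdist_eq_of_isPath hloop hP hw (hcP ▸ mem_image_of_mem c hs)
    simp [boundaryPotential, this, hρ.ne']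

theorem boundaryPotential_pt_of_ne (hf : G.IsBoundaryEdge w f) {e : E} (he : e ≠ f)
    (t : ℝ) {s : ℝ} (hs : s ∈ Icc 0 (G.len e)) : G.boundaryPotential w f t (G.pt e s) = 0 := by
  have h := (hf e).not.mpr he
  rw [not_or] at h
  have hρ := G.len_pos f
  rw [boundaryPotential, vdist_pt hρ hf.len_le e hs]
  simp [h.1, h.2, hρ.ne']

theorem boundaryPotential_pt_pos (hf : G.IsBoundaryEdge w f) {t : ℝ} (ht : 0 < t) {s : ℝ}
    (hs : s ∈ Ioo 0 (G.len f)) : 0 < G.boundaryPotential w f t (G.pt f s) := by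
  have hρ := G.len_pos f
  refine mul_pos ht ?_
  rw [sub_pos, div_lt_one hρ, vdist_pt hρ hf.len_le f (Ioo_subset_Icc_self hs), min_lt_iff]
  right
  rcases (hf f).mpr rfl with h | h
  · exact min_lt_of_left_lt (by simpa [h] using hs.2)
  · exact min_lt_of_right_lt (by simpa [h] using hs.1)

theorem continuous_boundaryPotential (hf : G.IsBoundaryEdge w f) (t : ℝ) :
    Continuous (G.boundaryPotential w f t) := by
  have := continuous_vdist (G.len_pos f) hf.len_le
  unfold boundaryPotential
  fun_prop

end IsBoundaryEdge

/-! ### The two sides of an edge of a tree -/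

/-- The vertices that can be reached from `b` without using the edge `f`. -/
def side (G : MetricGraph V E) (f : E) (b : V) : Set V :=
  {v | (G.toSimpleGraph.deleteEdges {s(G.src f, G.tgt f)}).Reachable b v}

namespace IsTree

variable {f : E}

theorem adj (hG : G.IsTree) (e : E) : G.toSimpleGraph.Adj (G.src e) (G.tgt e) := by
  rw [toSimpleGraph, SimpleGraph.fromRel_adj]
  exact ⟨hG.1 e, .inl ⟨e, rfl, rfl⟩⟩

theorem src_mem_side_iff (hG : G.IsTree) {e : E} (he : e ≠ f) (b : V) :
    G.src e ∈ G.side f b ↔ G.tgt e ∈ G.side f b := by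
  have h : (G.toSimpleGraph.deleteEdges {s(G.src f, G.tgt f)}).Adj (G.src e) (G.tgt e) := by
    rw [SimpleGraph.deleteEdges_adj]
    exact ⟨hG.adj e, fun h => he (hG.2.1 e f h)⟩
  exact ⟨fun h' => h'.trans h.reachable, fun h' => h'.trans h.symm.reachable⟩

theorem not_reachable (hG : G.IsTree) (f : E) :
    ¬ (G.toSimpleGraph.deleteEdges {s(G.src f, G.tgt f)}).Reachable (G.src f) (G.tgt f) :=
  SimpleGraph.isBridge_iff.mp
    (SimpleGraph.isAcyclic_iff_forall_adj_isBridge.mp hG.2.2.isAcyclic (hG.adj f))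

theorem disjoint_side (hG : G.IsTree) (f : E) :
    Disjoint (G.side f (G.src f)) (G.side f (G.tgt f)) :=
  Set.disjoint_left.mpr fun _ h h' => hG.not_reachable f (h.trans h'.symm)

theorem eq_of_values_eq (hG : G.IsTree) {α : Type*} {b : V → α}
    (hb : ∀ e, b (G.src e) = b (G.tgt e)) (v w : V) : b v = b w := by
  have hadj : ∀ v w, G.toSimpleGraph.Adj v w → b v = b w := by
    intro v w h
    rw [toSimpleGraph, SimpleGraph.fromRel_adj] at h
    obtain ⟨-, ⟨e, rfl, rfl⟩ | ⟨e, rfl, rfl⟩⟩ := h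
    · exact hb e
    · exact (hb e).symm
  obtain ⟨p⟩ := hG.2.2.connected.preconnected v w
  induction p with
  | nil => rfl
  | cons h _ ih => exact (hadj _ _ h).trans ih

/-- In a tree, a vertex has at most one neighbour that is closer to a given vertex. -/
theorem _root_.SimpleGraph.IsTree.eq_of_adj_of_dist_lt {T : SimpleGraph V} (hT : T.IsTree)
    {a w y z : V} (hy : T.Adj w y) (hz : T.Adj w z) (hy' : T.dist a y < T.dist a w)
    (hz' : T.dist a z < T.dist a w) : y = z := by
  -- A shortest path to `y`, extended by the edge to `w`, is again a path. Paths from `a` to `w`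
  -- being unique, its penultimate vertex is determined.
  have key : ∀ y, T.Adj w y → T.dist a y < T.dist a w →
      ∃ p : T.Walk a w, p.IsPath ∧ p.penultimate = y := by
    intro y hy hlt
    obtain ⟨p, hp, hlen⟩ := hT.connected.exists_path_of_dist a y
    have hw : w ∉ p.support := by
      classical
      intro h
      have := SimpleGraph.dist_le (p.takeUntil w h)
      have := p.length_takeUntil_le_length h
      omega
    exact ⟨p.concat hy.symm, hp.concat hw hy.symm, by simp⟩
  obtain ⟨p, hp, rfl⟩ := key y hy hy'
  obtain ⟨p', hp', rfl⟩ := key z hz hz'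
  rw [(hT.existsUnique_path a w).unique hp hp']

/-- Each side of an edge of a tree contains a boundary vertex. -/
theorem exists_isBoundaryEdge [Finite E] (hG : G.IsTree) {a b : V}
    (hab : a = G.src f ∧ b = G.tgt f ∨ a = G.tgt f ∧ b = G.src f) :
    ∃ w ∈ G.side f b, ∃ e, G.IsBoundaryEdge w e := by
  have := G.finite_vertices
  set T := G.toSimpleGraph with hTdef
  have hT : T.IsTree := hG.2.2
  -- A vertex of the side farthest from `a` works: all its neighbours are closer to `a`, so there is
  -- only one.
  obtain ⟨w, hw, hmax⟩ := Set.exists_max_image (G.side f b) (fun v => T.dist a v)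
    (Set.toFinite _) ⟨b, SimpleGraph.Reachable.refl _⟩
  have hadj : T.Adj a b := by
    rcases hab with ⟨rfl, rfl⟩ | ⟨rfl, rfl⟩
    · exact hG.adj f
    · exact (hG.adj f).symm
  have ha : a ∉ G.side f b := by
    rcases hab with ⟨rfl, rfl⟩ | ⟨rfl, rfl⟩
    · exact fun h => hG.not_reachable f h.symm
    · exact fun h => hG.not_reachable f h
  have hlt : ∀ e y, (G.src e = w ∧ G.tgt e = y ∨ G.tgt e = w ∧ G.src e = y) →
      T.Adj w y ∧ T.dist a y < T.dist a w := by
    intro e y h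
    have hwy : T.Adj w y := by
      rcases h with ⟨rfl, rfl⟩ | ⟨rfl, rfl⟩
      · exact hG.adj e
      · exact (hG.adj e).symm
    refine ⟨hwy, ?_⟩
    -- The edge `f` leads back to `a` itself. Any other edge stays in the side, where maximality
    -- applies, and adjacent vertices of a tree have different distances to `a`.
    by_cases he : e = f
    · subst he
      have : y = a := by
        rcases h with ⟨rfl, rfl⟩ | ⟨rfl, rfl⟩ <;> rcases hab with ⟨rfl, rfl⟩ | ⟨rfl, rfl⟩ <;>
          first
          | rfl
          | exact absurd hw ha
      rw [this, SimpleGraph.dist_self]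
      exact hT.connected.pos_dist_of_ne (this ▸ hwy.ne.symm)
    · have hy : y ∈ G.side f b := by
        rcases h with ⟨rfl, rfl⟩ | ⟨rfl, rfl⟩
        · exact (hG.src_mem_side_iff he b).mp hw
        · exact (hG.src_mem_side_iff he b).mpr hw
      exact (hmax y hy).lt_of_ne (hT.dist_ne_of_adj a hwy).symm
  have hother : ∀ e, G.src e = w ∨ G.tgt e = w →
      ∃ y, G.src e = w ∧ G.tgt e = y ∨ G.tgt e = w ∧ G.src e = y := by
    rintro e (h | h)
    · exact ⟨_, .inl ⟨h, rfl⟩⟩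
    · exact ⟨_, .inr ⟨h, rfl⟩⟩
  obtain ⟨e₁, he₁⟩ := G.exists_incident w
  refine ⟨w, hw, e₁, fun e => ⟨fun he => ?_, fun he => he ▸ he₁⟩⟩
  obtain ⟨y, hy⟩ := hother e he
  obtain ⟨z, hz⟩ := hother e₁ he₁
  obtain rfl : y = z := hT.eq_of_adj_of_dist_lt (hlt e y hy).1 (hlt e₁ z hz).1
    (hlt e y hy).2 (hlt e₁ z hz).2
  refine hG.2.1 e e₁ ?_
  rcases hy with ⟨h1, h2⟩ | ⟨h1, h2⟩ <;> rcases hz with ⟨h3, h4⟩ | ⟨h3, h4⟩ <;>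
    simp [h1, h2, h3, h4]

end IsTree

/-! ### Classical solutions -/

namespace HasSobolevDeriv

variable {ℓ : ℝ} {f g : ℝ → ℝ}

theorem integrableOn (h : HasSobolevDeriv ℓ f g) : IntegrableOn g (Icc 0 ℓ) := by
  rw [integrableOn_Icc_iff_integrableOn_Ioo]
  exact h.1.integrable one_le_two

theorem continuousOn (h : HasSobolevDeriv ℓ f g) : ContinuousOn f (Icc 0 ℓ) := by
  rcases le_or_gt 0 ℓ with hℓ | hℓ
  · have := intervalIntegral.continuousOn_primitive_interval (μ := volume) (f := g) (a := 0) (b := ℓ)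
      (by rw [uIcc_of_le hℓ]; exact h.integrableOn)
    rw [uIcc_of_le hℓ] at this
    exact (continuousOn_const.add this).congr h.2
  · simp [Icc_eq_empty hℓ.not_ge]

theorem congr_ae {g' : ℝ → ℝ} (h : HasSobolevDeriv ℓ f g)
    (hg : g =ᵐ[volume.restrict (Ioo 0 ℓ)] g') : HasSobolevDeriv ℓ f g' := by
  refine ⟨h.1.ae_eq hg, fun x hx => ?_⟩
  rw [h.2 x hx]
  congr 1
  refine intervalIntegral.integral_congr_ae_restrict ?_
  rw [uIoc_of_le hx.1, restrict_Ioo_eq_restrict_Ioc] at *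
  exact ae_restrict_of_ae_restrict_of_subset (Ioc_subset_Ioc_right hx.2) hg

theorem hasDerivAt (h : HasSobolevDeriv ℓ f g) (hg : ContinuousOn g (Icc 0 ℓ)) {s : ℝ}
    (hs : s ∈ Ioo 0 ℓ) : HasDerivAt f (g s) s := by
  have hnhds : Icc 0 ℓ ∈ 𝓝 s := Icc_mem_nhds hs.1 hs.2
  have hint : IntervalIntegrable g volume 0 s := by
    rw [intervalIntegrable_iff_integrableOn_Icc_of_le hs.1.le]
    exact h.integrableOn.mono_set (Icc_subset_Icc_right hs.2.le)
  have := intervalIntegral.integral_hasDerivAt_right hint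
    ((hg.mono Ioo_subset_Icc_self).stronglyMeasurableAtFilter isOpen_Ioo s hs)
    (hg.continuousAt hnhds)
  refine (this.const_add (f 0)).congr_of_eventuallyEq ?_
  filter_upwards [hnhds] with x hx using h.2 x hx

theorem of_hasDerivAt (hf : ContinuousOn f (Icc 0 ℓ)) (hg : ContinuousOn g (Icc 0 ℓ))
    (h : ∀ s ∈ Ioo 0 ℓ, HasDerivAt f (g s) s) : HasSobolevDeriv ℓ f g := by
  constructor
  · obtain ⟨C, hC⟩ := isCompact_Icc.exists_bound_of_continuousOn hg
    refine MemLp.of_bound ((hg.mono Ioo_subset_Icc_self).aestronglyMeasurable measurableSet_Ioo) C ?_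
    filter_upwards [ae_restrict_mem measurableSet_Ioo] with s hs
    exact hC s (Ioo_subset_Icc_self hs)
  · intro x hx
    have hsub : Icc 0 x ⊆ Icc 0 ℓ := Icc_subset_Icc_right hx.2
    rw [intervalIntegral.integral_eq_sub_of_hasDerivAt_of_le hx.1 (hf.mono hsub)
      (fun s hs => h s ⟨hs.1, hs.2.trans_le hx.2⟩)]
    · ring
    · exact (hg.mono (by rw [uIcc_of_le hx.1]; exact hsub)).intervalIntegrable

end HasSobolevDeriv

/-- `u`, with derivative `du` along the edges, is a classical solution of `-u'' + q u = μ u` that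
satisfies the Kirchhoff conditions. -/
structure IsSolution [Fintype E] (G : MetricGraph V E) (q : G.Point → ℝ) (μ : ℝ)
    (u : G.Point → ℝ) (du : E → ℝ → ℝ) : Prop where
  continuous : Continuous u
  continuousOn_deriv : ∀ e, ContinuousOn (du e) (Icc 0 (G.len e))
  hasDerivAt : ∀ e, ∀ s ∈ Ioo 0 (G.len e), HasDerivAt (fun s => u (G.pt e s)) (du e s) s
  hasDerivAt_deriv : ∀ e, ∀ s ∈ Ioo 0 (G.len e),
    HasDerivAt (du e) ((q (G.pt e s) - μ) * u (G.pt e s)) s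
  kirchhoff : ∀ v, G.normalDerivSum du v = 0

theorem continuousOn_comp_pt {u : G.Point → ℝ} (hu : Continuous u) (e : E) :
    ContinuousOn (fun s => u (G.pt e s)) (Icc 0 (G.len e)) :=
  hu.comp_continuousOn (continuousOn_pt e)

section

variable [Fintype E] {q : G.Point → ℝ} {μ : ℝ} {u : G.Point → ℝ} {du : E → ℝ → ℝ}

/-- The equation equates the weak second derivative almost everywhere with the continuous function
`(q - μ) u`, so the eigenfunction is classical. -/
theorem IsEigenfunction.exists_isSolution (hu : G.IsEigenfunction q μ u) (hq : Continuous q) :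
    ∃ du, G.IsSolution q μ u du := by
  obtain ⟨-, hcont, du, ddu, h1, h2, hk, heq⟩ := hu
  have hc : ∀ e, ContinuousOn (fun s => (q (G.pt e s) - μ) * u (G.pt e s)) (Icc 0 (G.len e)) :=
    fun e => continuousOn_comp_pt (u := fun x => (q x - μ) * u x) (by fun_prop) e
  have h2' : ∀ e, HasSobolevDeriv (G.len e) (du e)
      (fun s => (q (G.pt e s) - μ) * u (G.pt e s)) := by
    refine fun e => (h2 e).congr_ae ?_
    filter_upwards [heq e] with s hs
    linear_combination -hs
  exact ⟨du, hcont, fun e => (h2 e).continuousOn,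
    fun e s hs => (h1 e).hasDerivAt (h2 e).continuousOn hs,
    fun e s hs => (h2' e).hasDerivAt (hc e) hs, hk⟩

theorem IsSolution.isEigenfunction (hu : G.IsSolution q μ u du) (hq : Continuous q)
    (h0 : u ≠ 0) : G.IsEigenfunction q μ u := by
  have hcont := hu.continuous
  have hc : ∀ e, ContinuousOn (fun s => (q (G.pt e s) - μ) * u (G.pt e s)) (Icc 0 (G.len e)) :=
    fun e => continuousOn_comp_pt (u := fun x => (q x - μ) * u x) (by fun_prop) e
  refine ⟨h0, hcont, du, fun e s => (q (G.pt e s) - μ) * u (G.pt e s),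
    fun e => .of_hasDerivAt (continuousOn_comp_pt hcont e) (hu.continuousOn_deriv e)
      (hu.hasDerivAt e),
    fun e => .of_hasDerivAt (hu.continuousOn_deriv e) (hc e) (hu.hasDerivAt_deriv e),
    hu.kirchhoff, fun e => Eventually.of_forall fun s => ?_⟩
  ring

/-! ### Summation by parts on the graph and energy identities -/

theorem sum_mul_normalDerivSum [Fintype V] (b : V → ℝ) (du : E → ℝ → ℝ) :
    ∑ v, b v * G.normalDerivSum du v =
      ∑ e, (b (G.tgt e) * du e (G.len e) - b (G.src e) * du e 0) := by
  classical
  simp only [normalDerivSum, Finset.mul_sum]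
  rw [Finset.sum_comm]
  refine Finset.sum_congr rfl fun e _ => ?_
  simp only [mul_add, mul_ite, mul_zero, Finset.sum_add_distrib, Finset.sum_ite_eq,
    Finset.mem_univ, if_true]
  ring

/-- The total flux of a field satisfying the Kirchhoff conditions, weighted by a function on the
vertices, vanishes. -/
theorem sum_flux_eq_zero (hk : ∀ v, G.normalDerivSum du v = 0) (b : V → ℝ) :
    ∑ e, (b (G.tgt e) * du e (G.len e) - b (G.src e) * du e 0) = 0 := by
  have := G.finite_vertices
  have : Fintype V := Fintype.ofFinite V
  rw [← sum_mul_normalDerivSum]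
  simp [hk]

/-- If functions on the edges have nonnegative derivatives and their increments add up to zero, then
the derivatives vanish. -/
theorem deriv_eq_zero_of_sum_increments {g g' : E → ℝ → ℝ}
    (hg : ∀ e, ContinuousOn (g e) (Icc 0 (G.len e)))
    (hd : ∀ e, ∀ s ∈ Ioo 0 (G.len e), HasDerivAt (g e) (g' e s) s)
    (h0 : ∀ e, ∀ s ∈ Ioo 0 (G.len e), 0 ≤ g' e s)
    (hsum : ∑ e, (g e (G.len e) - g e 0) = 0) (e : E) (s : ℝ) (hs : s ∈ Ioo 0 (G.len e)) :
    g' e s = 0 := by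
  have hmono : ∀ e, MonotoneOn (g e) (Icc 0 (G.len e)) := by
    intro e
    refine monotoneOn_of_deriv_nonneg (convex_Icc _ _) (hg e) ?_ ?_ <;> rw [interior_Icc]
    · exact fun s hs => (hd e s hs).differentiableAt.differentiableWithinAt
    · exact fun s hs => (hd e s hs).deriv ▸ h0 e s hs
  have hz := (Finset.sum_eq_zero_iff_of_nonneg fun e _ => sub_nonneg.mpr
    (hmono e (zero_mem e) (len_mem e) (G.len_pos e).le)).mp hsum e (Finset.mem_univ e)
  have hconst : ∀ r ∈ Icc 0 (G.len e), g e r = g e 0 := fun r hr =>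
    le_antisymm ((hmono e hr (len_mem e) hr.2).trans (by linarith))
      (hmono e (zero_mem e) hr hr.1)
  have : HasDerivAt (g e) 0 s := by
    refine (hasDerivAt_const s (g e 0)).congr_of_eventuallyEq ?_
    filter_upwards [Icc_mem_nhds hs.1 hs.2] with r hr using hconst r hr
  exact (hd e s hs).unique this

theorem eqOn_Icc_of_eqOn_Ioo {a b : ℝ} (hab : a < b) {f g : ℝ → ℝ}
    (hf : ContinuousOn f (Icc a b)) (hg : ContinuousOn g (Icc a b)) (h : EqOn f g (Ioo a b)) :
    EqOn f g (Icc a b) :=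
  h.of_subset_closure hf hg Ioo_subset_Icc_self (by rw [closure_Ioo hab.ne])

/-- The eigenvalue of a positive eigenfunction is the smallest one. -/
theorem IsSolution.le_of_pos {φ : G.Point → ℝ} {dφ : E → ℝ → ℝ} {ν : ℝ}
    (hφ : G.IsSolution q μ φ dφ) (hpos : ∀ x, 0 < φ x) (hu : G.IsSolution q ν u du)
    (h0 : u ≠ 0) : μ ≤ ν := by
  by_contra! hlt
  have hu' := fun e => continuousOn_comp_pt hu.continuous e
  have hφ' := fun e => continuousOn_comp_pt hφ.continuous e
  -- Picone's identity: `u u' - (u² / φ) φ'` has derivative `(μ - ν) u² + (u' - φ' u / φ)²`. Its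
  -- increments sum to zero by the Kirchhoff conditions weighted with `u` and `u² / φ`.
  have key := deriv_eq_zero_of_sum_increments (G := G)
    (g := fun e s => u (G.pt e s) * du e s - u (G.pt e s) ^ 2 / φ (G.pt e s) * dφ e s)
    (g' := fun e s => (μ - ν) * u (G.pt e s) ^ 2 +
      (du e s - dφ e s * u (G.pt e s) / φ (G.pt e s)) ^ 2) ?_ ?_ ?_ ?_
  · refine h0 (funext fun x => ?_)
    obtain ⟨e, s, hs, rfl⟩ := exists_pt_eq x
    refine eqOn_Icc_of_eqOn_Ioo (G.len_pos e) (hu' e) continuousOn_const (fun s hs => ?_) hs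
    have h1 := key e s hs
    have h2 : (μ - ν) * u (G.pt e s) ^ 2 = 0 := by
      nlinarith [sq_nonneg (du e s - dφ e s * u (G.pt e s) / φ (G.pt e s)),
        mul_nonneg (sub_pos.mpr hlt).le (sq_nonneg (u (G.pt e s)))]
    simpa [(sub_pos.mpr hlt).ne'] using h2
  · exact fun e => ((hu' e).mul (hu.continuousOn_deriv e)).sub
      ((((hu' e).pow 2).div (hφ' e) fun s _ => (hpos _).ne').mul (hφ.continuousOn_deriv e))
  · intro e s hs
    have hne := (hpos (G.pt e s)).ne'
    have d1 := hu.hasDerivAt e s hs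
    have d2 := hu.hasDerivAt_deriv e s hs
    have d3 := hφ.hasDerivAt e s hs
    have d4 := hφ.hasDerivAt_deriv e s hs
    refine ((d1.mul d2).sub (((d1.pow 2).div d3 hne).mul d4)).congr_deriv ?_
    simp only [Pi.pow_apply, Pi.div_apply]
    field_simp
    ring
  · exact fun e s _ => add_nonneg (mul_nonneg (sub_pos.mpr hlt).le (sq_nonneg _)) (sq_nonneg _)
  · have s1 := sum_flux_eq_zero hu.kirchhoff fun v => u (.vertex v)
    have s2 := sum_flux_eq_zero hφ.kirchhoff fun v => u (.vertex v) ^ 2 / φ (.vertex v)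
    refine Eq.trans ?_ (sub_eq_zero.mpr (s1.trans s2.symm))
    rw [← Finset.sum_sub_distrib]
    refine Finset.sum_congr rfl fun e _ => ?_
    simp only [pt_zero, pt_len]
    ring

/-- If `q ≥ 0` is positive somewhere, the eigenvalue of a positive eigenfunction is positive. -/
theorem IsSolution.eigenvalue_pos (hu : G.IsSolution q μ u du) (hpos : ∀ x, 0 < u x)
    (hq : ∀ x, 0 ≤ q x) {e : E} {s : ℝ} (hs : s ∈ Ioo 0 (G.len e)) (hqs : 0 < q (G.pt e s)) :
    0 < μ := by
  by_contra! hμ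
  -- If `μ ≤ 0`, then `u'' = (q - μ) u ≥ 0`, while the total flux of `u'` is zero; so `u''`
  -- vanishes, which fails where `q > 0`.
  have key := deriv_eq_zero_of_sum_increments hu.continuousOn_deriv hu.hasDerivAt_deriv
    (fun e s _ => mul_nonneg (by linarith [hq (G.pt e s)]) (hpos _).le)
    (by simpa using sum_flux_eq_zero hu.kirchhoff fun _ => 1) e s hs
  rcases mul_eq_zero.mp key with h | h
  · linarith
  · exact (hpos _).ne' h

theorem isSolution_one : G.IsSolution 0 0 1 0 where
  continuous := continuous_const
  continuousOn_deriv _ := continuousOn_const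
  hasDerivAt _ s _ := hasDerivAt_const s 1
  hasDerivAt_deriv _ s _ := by simp
  kirchhoff v := by simp [normalDerivSum]

/-- The eigenfunctions of the Laplacian for the eigenvalue `0` are constant. -/
theorem IsSolution.eq_of_zero (hG : G.IsTree) (hu : G.IsSolution 0 0 u du) (x y : G.Point) :
    u x = u y := by
  have hu' := fun e => continuousOn_comp_pt hu.continuous e
  -- Energy identity: `(u u')' = u'²` when `q = μ = 0`, so `u' = 0` on every edge.
  have key := deriv_eq_zero_of_sum_increments (G := G)
    (g := fun e s => u (G.pt e s) * du e s) (g' := fun e s => du e s ^ 2)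
    (fun e => (hu' e).mul (hu.continuousOn_deriv e))
    (fun e s hs => ((hu.hasDerivAt e s hs).mul (hu.hasDerivAt_deriv e s hs)).congr_deriv
      (by simp only [Pi.zero_apply]; ring))
    (fun _ _ _ => sq_nonneg _)
    (by simpa [pt_zero, pt_len] using sum_flux_eq_zero hu.kirchhoff fun v => u (.vertex v))
  have hconst : ∀ e, ∀ s ∈ Icc 0 (G.len e), u (G.pt e s) = u (G.pt e 0) := by
    intro e
    refine constant_of_has_deriv_right_zero (hu' e) fun s hs => ?_
    rcases hs.1.eq_or_lt with rfl | h
    · have hd : HasDerivWithinAt (fun s => u (G.pt e s)) (du e 0) (Ici 0) 0 := by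
        refine hasDerivWithinAt_Ici_of_tendsto_deriv (s := Ioo 0 (G.len e))
          (fun s hs => (hu.hasDerivAt e s hs).differentiableAt.differentiableWithinAt)
          ((hu' e 0 (zero_mem e)).mono Ioo_subset_Icc_self) (Ioo_mem_nhdsGT (G.len_pos e)) ?_
        have h1 : Tendsto (du e) (𝓝[>] 0) (𝓝 (du e 0)) :=
          ((hu.continuousOn_deriv e 0 (zero_mem e)).mono Ioo_subset_Icc_self).tendsto.mono_left
            (by rw [nhdsWithin_Ioo_eq_nhdsGT (G.len_pos e)])
        refine h1.congr' ?_
        filter_upwards [Ioo_mem_nhdsGT (G.len_pos e)] with s hs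
        exact (hu.hasDerivAt e s hs).deriv.symm
      have : du e 0 = 0 := eqOn_Icc_of_eqOn_Ioo (G.len_pos e) (hu.continuousOn_deriv e)
        continuousOn_const (fun s hs => pow_eq_zero_iff two_ne_zero |>.mp (key e s hs)) (zero_mem e)
      rwa [this] at hd
    · have := (hu.hasDerivAt e s ⟨h, hs.2⟩).hasDerivWithinAt (s := Ici s)
      rwa [pow_eq_zero_iff two_ne_zero |>.mp (key e s ⟨h, hs.2⟩)] at this
  have hv : ∀ v w, u (.vertex v) = u (.vertex w) := by
    refine hG.eq_of_values_eq (b := fun v => u (.vertex v)) fun e => ?_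
    rw [← pt_zero, ← pt_len, hconst e _ (len_mem e)]
  obtain ⟨e, s, hs, rfl⟩ := exists_pt_eq x
  obtain ⟨e', s', hs', rfl⟩ := exists_pt_eq y
  rw [hconst e s hs, hconst e' s' hs', pt_zero, pt_zero, hv]

end

/-! ### Cutting off a solution that vanishes on an edge -/

open Classical in
/-- The function that agrees with `u`, except that it is zero on the edges with an end in `B`. -/
def cutoff (B : Set V) (u : G.Point → ℝ) : G.Point → ℝ :=
  glue (fun v => if v ∈ B then 0 else u (.vertex v))
    fun e s => if G.src e ∈ B ∨ G.tgt e ∈ B then 0 else u (G.pt e s)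

section cutoff

variable {B : Set V} {f : E} {u : G.Point → ℝ}

open Classical in
-- Edges other than `f` have both ends in `B` or neither, and `u` is zero on `f`, so the vertex
-- values match the edge values.
theorem cutoff_pt (hB : ∀ e, e ≠ f → (G.src e ∈ B ↔ G.tgt e ∈ B))
    (hu : ∀ s ∈ Icc 0 (G.len f), u (G.pt f s) = 0) (e : E) {s : ℝ} (hs : s ∈ Icc 0 (G.len e)) :
    cutoff B u (G.pt e s) = if G.src e ∈ B ∨ G.tgt e ∈ B then 0 else u (G.pt e s) := by
  have h0 := hu 0 (zero_mem f)
  have h1 := hu _ (len_mem f)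
  rw [pt_zero] at h0
  rw [pt_len] at h1
  refine glue_pt ?_ ?_ hs
  · simp only [pt_zero]
    by_cases he : e = f
    · subst he; simp [h0]
    · simp [← hB e he]
  · simp only [pt_len]
    by_cases he : e = f
    · subst he; simp [h1]
    · simp [hB e he]

open Classical in
-- Since `u'` also vanishes on `f`, that edge contributes nothing to the Kirchhoff sums. The other
-- edges at a vertex are all erased or all kept.
theorem IsSolution.cutoff [Fintype E] {q : G.Point → ℝ} {μ : ℝ} {du : E → ℝ → ℝ}
    (h : G.IsSolution q μ u du) (hB : ∀ e, e ≠ f → (G.src e ∈ B ↔ G.tgt e ∈ B))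
    (hu : ∀ s ∈ Icc 0 (G.len f), u (G.pt f s) = 0) :
    G.IsSolution q μ (cutoff B u)
      (fun e s => if G.src e ∈ B ∨ G.tgt e ∈ B then 0 else du e s) := by
  have hdu : ∀ s ∈ Icc 0 (G.len f), du f s = 0 := by
    refine eqOn_Icc_of_eqOn_Ioo (G.len_pos f) (h.continuousOn_deriv f) continuousOn_const
      fun s hs => ?_
    refine (h.hasDerivAt f s hs).unique ((hasDerivAt_const s 0).congr_of_eventuallyEq ?_)
    filter_upwards [Icc_mem_nhds hs.1 hs.2] with r hr using hu r hr
  have hloc : ∀ e, ∀ s ∈ Ioo 0 (G.len e), (fun s => MetricGraph.cutoff B u (G.pt e s)) =ᶠ[𝓝 s]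
      fun s => if G.src e ∈ B ∨ G.tgt e ∈ B then 0 else u (G.pt e s) := by
    intro e s hs
    filter_upwards [Icc_mem_nhds hs.1 hs.2] with r hr using cutoff_pt hB hu e hr
  refine ⟨continuous_of_continuousOn_edges fun e => ?_, fun e => ?_, fun e s hs => ?_,
    fun e s hs => ?_, fun v => ?_⟩
  · refine ContinuousOn.congr ?_ fun s hs => cutoff_pt hB hu e hs
    split_ifs
    · exact continuousOn_const
    · exact continuousOn_comp_pt h.continuous e
  · split_ifs
    · exact continuousOn_const
    · exact h.continuousOn_deriv e
  · refine HasDerivAt.congr_of_eventuallyEq ?_ (hloc e s hs)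
    split_ifs
    · exact hasDerivAt_const _ _
    · exact h.hasDerivAt e s hs
  · rw [cutoff_pt hB hu e (Ioo_subset_Icc_self hs)]
    split_ifs
    · simpa using hasDerivAt_const s (0 : ℝ)
    · exact h.hasDerivAt_deriv e s hs
  · by_cases hv : v ∈ B
    · refine Finset.sum_eq_zero fun e _ => ?_
      split_ifs <;> simp_all
    · refine Eq.trans (Finset.sum_congr rfl fun e _ => ?_) (h.kirchhoff v)
      by_cases he : e = f
      · subst he
        simp [hdu 0 (zero_mem e), hdu _ (len_mem e)]
      · have := hB e he
        congr 1 <;> split_ifs <;> simp_all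

end cutoff

/-- In a tree, if a nonzero solution vanishes on an edge, then there is a nonzero solution of the same
equation that vanishes on a boundary edge. -/
theorem IsTree.exists_isSolution_boundaryEdge [Fintype E] (hG : G.IsTree) {μ : ℝ}
    {u : G.Point → ℝ} {du : E → ℝ → ℝ} {q : G.Point → ℝ} (h : G.IsSolution q μ u du) (h0 : u ≠ 0)
    {f : E} (hu : ∀ s ∈ Icc 0 (G.len f), u (G.pt f s) = 0) :
    ∃ w e u' du', G.IsBoundaryEdge w e ∧ G.IsSolution q μ u' du' ∧ u' ≠ 0 ∧
      ∀ s ∈ Icc 0 (G.len e), u' (G.pt e s) = 0 := by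
  classical
  have key : ∀ a b, (a = G.src f ∧ b = G.tgt f ∨ a = G.tgt f ∧ b = G.src f) →
      cutoff (G.side f b) u ≠ 0 → ∃ w e u' du', G.IsBoundaryEdge w e ∧ G.IsSolution q μ u' du' ∧
        u' ≠ 0 ∧ ∀ s ∈ Icc 0 (G.len e), u' (G.pt e s) = 0 := by
    intro a b hab hne
    have hB : ∀ e, e ≠ f → (G.src e ∈ G.side f b ↔ G.tgt e ∈ G.side f b) :=
      fun e he => hG.src_mem_side_iff he b
    obtain ⟨w, hw, e, he⟩ := hG.exists_isBoundaryEdge hab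
    refine ⟨w, e, _, _, he, h.cutoff hB hu, hne, fun s hs => ?_⟩
    rw [cutoff_pt hB hu e hs, if_pos]
    rcases (he e).mpr rfl with rfl | rfl
    · exact .inl hw
    · exact .inr hw
  by_contra hcon
  have c1 : cutoff (G.side f (G.tgt f)) u = 0 :=
    by_contra fun hne => hcon (key _ _ (.inl ⟨rfl, rfl⟩) hne)
  have c2 : cutoff (G.side f (G.src f)) u = 0 :=
    by_contra fun hne => hcon (key _ _ (.inr ⟨rfl, rfl⟩) hne)
  -- The two sides are disjoint, so every edge other than `f` survives one of the two cutoffs; if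
  -- both are zero, so is `u`.
  refine h0 (funext fun x => ?_)
  obtain ⟨e, s, hs, rfl⟩ := exists_pt_eq x
  by_cases he : e = f
  · subst he
    exact hu s hs
  have d1 := cutoff_pt (fun e he => hG.src_mem_side_iff he (G.tgt f)) hu e hs
  have d2 := cutoff_pt (fun e he => hG.src_mem_side_iff he (G.src f)) hu e hs
  simp only [c1, ← hG.src_mem_side_iff he, or_self] at d1
  simp only [c2, ← hG.src_mem_side_iff he, or_self] at d2
  by_cases hmem : G.src e ∈ G.side f (G.tgt f)
  · rw [if_neg (Set.disjoint_right.mp (hG.disjoint_side f) hmem)] at d2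
    exact d2.symm
  · rw [if_neg hmem] at d1
    exact d1.symm

/-! ### The ground state for a small potential -/

theorem normalDerivSum_add [Fintype E] (du du' : E → ℝ → ℝ) (v : V) :
    G.normalDerivSum (fun e s => du e s + du' e s) v =
      G.normalDerivSum du v + G.normalDerivSum du' v := by
  classical
  simp only [normalDerivSum, ← Finset.sum_add_distrib]
  refine Finset.sum_congr rfl fun e _ => ?_
  split_ifs <;> ring

theorem normalDerivSum_smul [Fintype E] (c : ℝ) (du : E → ℝ → ℝ) (v : V) :
    G.normalDerivSum (fun e s => c * du e s) v = c * G.normalDerivSum du v := by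
  classical
  simp only [normalDerivSum, Finset.mul_sum]
  refine Finset.sum_congr rfl fun e _ => ?_
  split_ifs <;> ring

/-- The graph Laplacian is onto the functions on the vertices of mean zero. -/
theorem IsTree.exists_normalDerivSum_eq [Fintype V] [Fintype E] (hG : G.IsTree) {r : V → ℝ}
    (hr : ∑ v, r v = 0) :
    ∃ b : V → ℝ, ∀ v,
      G.normalDerivSum (fun e _ => (b (G.tgt e) - b (G.src e)) / G.len e) v = r v := by
  have : Nonempty V := hG.2.2.connected.nonempty
  have hcard : (Fintype.card V : ℝ) ≠ 0 := by exact_mod_cast Fintype.card_ne_zero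
  have hsum : ∀ b : V → ℝ,
      ∑ v, G.normalDerivSum (fun e _ => (b (G.tgt e) - b (G.src e)) / G.len e) v = 0 := by
    intro b
    simpa using sum_mul_normalDerivSum (G := G) (fun _ => 1)
      (fun e _ => (b (G.tgt e) - b (G.src e)) / G.len e)
  -- The kernel of the Laplacian consists of constants; adding the total of `b` to every component
  -- makes the map injective, hence bijective. For data of mean zero the added term vanishes.
  let A : (V → ℝ) →ₗ[ℝ] (V → ℝ) :=
    { toFun := fun b v =>
        G.normalDerivSum (fun e _ => (b (G.tgt e) - b (G.src e)) / G.len e) v + ∑ w, b w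
      map_add' := fun b b' => by
        funext v
        simp only [Pi.add_apply, Finset.sum_add_distrib]
        have := normalDerivSum_add (G := G) (fun e _ => (b (G.tgt e) - b (G.src e)) / G.len e)
          (fun e _ => (b' (G.tgt e) - b' (G.src e)) / G.len e) v
        rw [add_add_add_comm, ← this]
        congr 2
        funext e _
        ring
      map_smul' := fun c b => by
        funext v
        simp only [Pi.smul_apply, smul_eq_mul, RingHom.id_apply, mul_add, Finset.mul_sum]
        rw [← normalDerivSum_smul]
        congr 2
        funext e _
        ring }
  have hA : ∀ b, ∑ v, A b v = Fintype.card V * ∑ w, b w := by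
    intro b
    simp [A, Finset.sum_add_distrib, hsum]
  have hinj : Function.Injective A := by
    refine (injective_iff_map_eq_zero A).mpr fun b hb => ?_
    have h0 : ∑ w, b w = 0 := by
      have := hA b
      rw [hb] at this
      simpa [hcard] using this.symm
    have hk : ∀ v, G.normalDerivSum (fun e _ => (b (G.tgt e) - b (G.src e)) / G.len e) v = 0 := by
      intro v
      have := congrFun hb v
      simpa [A, h0] using this
    have hflux := sum_flux_eq_zero hk b
    have hflux' : ∑ e, (b (G.tgt e) - b (G.src e)) ^ 2 / G.len e = 0 := by
      rw [← hflux]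
      exact Finset.sum_congr rfl fun e _ => by ring
    have hedge := (Finset.sum_eq_zero_iff_of_nonneg fun e _ =>
      div_nonneg (sq_nonneg (b (G.tgt e) - b (G.src e))) (G.len_pos e).le).mp hflux'
    have hconst := hG.eq_of_values_eq (b := b) fun e => by
      have := hedge e (Finset.mem_univ e)
      rw [div_eq_zero_iff, or_iff_left (G.len_pos e).ne', pow_eq_zero_iff two_ne_zero] at this
      linarith
    funext v
    rw [Finset.sum_congr rfl fun w _ => hconst w v] at h0
    simpa [hcard] using h0
  obtain ⟨b, hb⟩ := LinearMap.injective_iff_surjective.mp hinj r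
  have h0 : ∑ w, b w = 0 := by
    have := hA b
    rw [hb, hr] at this
    simpa [hcard] using this.symm
  refine ⟨b, fun v => ?_⟩
  have := congrFun hb v
  simpa [A, h0] using this

/-- The point of `[0, ℓ]` nearest to `s`. -/
def clamp (ℓ s : ℝ) : ℝ := max 0 (min s ℓ)

theorem clamp_of_mem {ℓ s : ℝ} (hs : s ∈ Icc 0 ℓ) : clamp ℓ s = s := by
  rw [clamp, min_eq_left hs.2, max_eq_right hs.1]

theorem clamp_mem {ℓ : ℝ} (hℓ : 0 ≤ ℓ) (s : ℝ) : clamp ℓ s ∈ Icc 0 ℓ :=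
  ⟨le_max_left _ _, max_le hℓ (min_le_right _ _)⟩

theorem abs_clamp_le (ℓ s : ℝ) : |clamp ℓ s| ≤ |ℓ| := by
  rw [abs_of_nonneg (le_max_left _ _)]
  exact max_le (abs_nonneg _) ((min_le_right _ _).trans (le_abs_self _))

theorem continuous_clamp (ℓ : ℝ) : Continuous (clamp ℓ) := by
  unfold clamp
  fun_prop

theorem abs_integral_clamp_le (ℓ : ℝ) (f : ℝ →ᵇ ℝ) (s : ℝ) :
    ‖∫ r in (0 : ℝ)..clamp ℓ s, f r‖ ≤ |ℓ| * ‖f‖ := by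
  refine (intervalIntegral.norm_integral_le_of_norm_le_const fun r _ => f.norm_coe_le_norm r).trans ?_
  rw [mul_comm, sub_zero]
  exact mul_le_mul_of_nonneg_right (abs_clamp_le ℓ s) (norm_nonneg _)

/-- The primitive of a function on `[0, ℓ]`, extended by constants. -/
def primitive (ℓ : ℝ) : (ℝ →ᵇ ℝ) →L[ℝ] (ℝ →ᵇ ℝ) :=
  LinearMap.mkContinuous
    { toFun := fun f => BoundedContinuousFunction.ofNormedAddCommGroup
        (fun s => ∫ r in (0 : ℝ)..clamp ℓ s, f r)
        ((intervalIntegral.continuous_primitive (fun _ _ => f.continuous.intervalIntegrable _ _)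
          0).comp (continuous_clamp ℓ)) (|ℓ| * ‖f‖) (abs_integral_clamp_le ℓ f)
      map_add' := fun f g => by
        ext s
        exact intervalIntegral.integral_add (f.continuous.intervalIntegrable _ _)
          (g.continuous.intervalIntegrable _ _)
      map_smul' := fun c f => by
        ext s
        exact intervalIntegral.integral_smul c f }
    |ℓ| fun f => BoundedContinuousFunction.norm_ofNormedAddCommGroup_le _
      (by positivity) (abs_integral_clamp_le ℓ f)

theorem primitive_apply (ℓ : ℝ) (f : ℝ →ᵇ ℝ) (s : ℝ) :
    primitive ℓ f s = ∫ r in (0 : ℝ)..clamp ℓ s, f r := rfl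

theorem primitive_zero {ℓ : ℝ} (hℓ : 0 ≤ ℓ) (f : ℝ →ᵇ ℝ) : primitive ℓ f 0 = 0 := by
  rw [primitive_apply, clamp_of_mem ⟨le_rfl, hℓ⟩, intervalIntegral.integral_same]

theorem primitive_one {ℓ s : ℝ} (hs : s ∈ Icc 0 ℓ) : primitive ℓ 1 s = s := by
  rw [primitive_apply, clamp_of_mem hs]
  simp

theorem hasDerivAt_primitive {ℓ s : ℝ} (f : ℝ →ᵇ ℝ) (hs : s ∈ Ioo 0 ℓ) :
    HasDerivAt (primitive ℓ f) (f s) s := by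
  refine (f.continuous.integral_hasStrictDerivAt 0 s).hasDerivAt.congr_of_eventuallyEq ?_
  filter_upwards [Icc_mem_nhds hs.1 hs.2] with r hr
  rw [primitive_apply, clamp_of_mem hr]

/-- For small positive multiples of a bounded continuous potential there is a positive eigenfunction
with a small eigenvalue. -/
theorem IsTree.exists_pos_isSolution [Fintype E] (hG : G.IsTree) {q : G.Point → ℝ}
    (hq : Continuous q) {C : ℝ} (hC : ∀ x, |q x| ≤ C) {ε : ℝ} (hε : 0 < ε) :
    ∃ t ∈ Ioo 0 ε, ∃ μ < ε, ∃ φ dφ, (∀ x, 0 < φ x) ∧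
      G.IsSolution (fun x => t * q x) μ φ dφ := by
  classical
  have := G.finite_vertices
  have : Fintype V := Fintype.ofFinite V
  have : Nonempty V := hG.2.2.connected.nonempty
  have : Nonempty E := ⟨(G.exists_incident (Classical.arbitrary V)).choose⟩
  have hlen : ∀ e, 0 ≤ G.len e := fun e => (G.len_pos e).le
  let Q : E → ℝ →ᵇ ℝ := fun e => BoundedContinuousFunction.ofNormedAddCommGroup
    (fun s => q (G.pt e (clamp (G.len e) s)))
    ((continuousOn_comp_pt hq e).comp_continuous (continuous_clamp _) (clamp_mem (hlen e))) C
    fun s => hC _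
  -- The unknowns: second derivatives `w` on the edges, vertex values `b`, initial slopes `d`, the
  -- eigenvalue `m` and the size `τ` of the potential.
  let Z := (E → ℝ →ᵇ ℝ) × (V → ℝ) × (E → ℝ) × ℝ × ℝ
  let w : Z →L[ℝ] (E → ℝ →ᵇ ℝ) := .fst ℝ _ _
  let b : Z →L[ℝ] (V → ℝ) := (ContinuousLinearMap.fst ℝ _ _).comp (.snd ℝ _ _)
  let d : Z →L[ℝ] (E → ℝ) :=
    (ContinuousLinearMap.fst ℝ _ _).comp ((ContinuousLinearMap.snd ℝ _ _).comp (.snd ℝ _ _))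
  let m : Z →L[ℝ] ℝ := (ContinuousLinearMap.fst ℝ _ _).comp
    ((ContinuousLinearMap.snd ℝ _ _).comp ((ContinuousLinearMap.snd ℝ _ _).comp (.snd ℝ _ _)))
  let τ : Z →L[ℝ] ℝ := (ContinuousLinearMap.snd ℝ _ _).comp
    ((ContinuousLinearMap.snd ℝ _ _).comp ((ContinuousLinearMap.snd ℝ _ _).comp (.snd ℝ _ _)))
  -- `R` integrates `w` twice with initial data `b` and `d`, and `D` is its derivative. Below, `N`
  -- measures the failure of continuity at the ends `len e`, and `K` that of Kirchhoff.
  let R : Z →L[ℝ] (E → ℝ →ᵇ ℝ) := ContinuousLinearMap.pi fun e =>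
    ((ContinuousLinearMap.proj (G.src e)).comp b).smulRight (1 : ℝ →ᵇ ℝ) +
    ((ContinuousLinearMap.proj e).comp d).smulRight (primitive (G.len e) 1) +
    (primitive (G.len e)).comp ((primitive (G.len e)).comp ((ContinuousLinearMap.proj e).comp w))
  let D : Z →L[ℝ] (E → ℝ →ᵇ ℝ) := ContinuousLinearMap.pi fun e =>
    ((ContinuousLinearMap.proj e).comp d).smulRight (1 : ℝ →ᵇ ℝ) +
    (primitive (G.len e)).comp ((ContinuousLinearMap.proj e).comp w)
  have hR : ∀ z e s, R z e s = b z (G.src e) + d z e * primitive (G.len e) 1 s +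
      primitive (G.len e) (primitive (G.len e) (w z e)) s := by
    intro z e s
    simp [R]
  have hD : ∀ z e s, D z e s = d z e + primitive (G.len e) (w z e) s := by
    intro z e s
    simp [D]
  let N : Z →L[ℝ] (E → ℝ) := ContinuousLinearMap.pi fun e =>
    (BoundedContinuousFunction.evalCLM ℝ (G.len e)).comp ((ContinuousLinearMap.proj e).comp R) -
      (ContinuousLinearMap.proj (G.tgt e)).comp b
  let K : Z →L[ℝ] (V → ℝ) := ContinuousLinearMap.pi fun v => ∑ e,
    ((if G.src e = v then
      -(BoundedContinuousFunction.evalCLM ℝ 0).comp ((ContinuousLinearMap.proj e).comp D) else 0) +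
    (if G.tgt e = v then
      (BoundedContinuousFunction.evalCLM ℝ (G.len e)).comp ((ContinuousLinearMap.proj e).comp D)
      else 0))
  have hN : ∀ z e, N z e = R z e (G.len e) - b z (G.tgt e) := fun z e => rfl
  have hK : ∀ z v, K z v = G.normalDerivSum (fun e s => D z e s) v := by
    intro z v
    simp only [K, normalDerivSum, ContinuousLinearMap.coe_pi', sum_apply]
    refine Finset.sum_congr rfl fun e _ => ?_
    split_ifs <;> simp
  let S : Z →L[ℝ] (E → ℝ →ᵇ ℝ) := τ.smulRight Q - m.smulRight 1
  let z₀ : Z := (0, 1, 0, 0, 0)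
  have hw₀ : w z₀ = 0 := rfl
  have hb₀ : b z₀ = 1 := rfl
  have hd₀ : d z₀ = 0 := rfl
  have hm₀ : m z₀ = 0 := rfl
  have hτ₀ : τ z₀ = 0 := rfl
  have hR₀ : R z₀ = 1 := by
    ext e s
    simp [hR, hw₀, hb₀, hd₀]
  have hS₀ : S z₀ = 0 := by simp [S, hm₀, hτ₀]
  -- A point with `Φ z = (0, 0, 0, t)` is a solution for `t * q` with eigenvalue `m z`; the base
  -- point `z₀` is the constant `1` with eigenvalue `0`.
  let Φ : Z → (E → ℝ →ᵇ ℝ) × (E → ℝ) × (V → ℝ) × ℝ :=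
    fun z => (w z - S z * R z, N z, K z, τ z)
  have hΦ₀ : Φ z₀ = 0 := by
    have h1 : N z₀ = 0 := by
      funext e
      rw [hN, hR₀]
      simp [hb₀]
    have h2 : K z₀ = 0 := by
      funext v
      rw [hK]
      have : D z₀ = 0 := by
        ext e s
        simp [hD, hd₀, hw₀]
      simp [this, normalDerivSum]
    simp [Φ, hS₀, h1, h2, hw₀, hτ₀]
  let Φ' : Z →L[ℝ] (E → ℝ →ᵇ ℝ) × (E → ℝ) × (V → ℝ) × ℝ :=
    (w - S).prod (N.prod (K.prod τ))
  have hderiv : HasStrictFDerivAt Φ Φ' z₀ := by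
    have h1 : HasStrictFDerivAt (fun z => w z - S z * R z) (w - S) z₀ := by
      have := w.hasStrictFDerivAt.sub (S.hasStrictFDerivAt.mul R.hasStrictFDerivAt (x := z₀))
      refine this.congr_fderiv ?_
      rw [hR₀, hS₀]
      refine ContinuousLinearMap.ext fun z => ?_
      change w z - (0 * R z + 1 * S z) = w z - S z
      rw [zero_mul, one_mul, zero_add]
    exact h1.prodMk (N.hasStrictFDerivAt.prodMk (K.hasStrictFDerivAt.prodMk τ.hasStrictFDerivAt))
  have hsurj : Function.Surjective Φ' := by
    rintro ⟨x, y, k, t⟩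
    have hlenpos : 0 < ∑ e, G.len e := Finset.sum_pos (fun e _ => G.len_pos e) Finset.univ_nonempty
    -- The total flux must equal the sum of the `k v`, which forces this `μ`. The slopes `β` absorb
    -- the jumps `y`, and the remaining Kirchhoff defect, now of mean zero, is removed by the graph
    -- Laplacian.
    set μ : ℝ := (∑ e, primitive (G.len e) (x e + t • Q e) (G.len e) - ∑ v, k v) / ∑ e, G.len e
      with hμ
    set W : E → ℝ →ᵇ ℝ := x + t • Q - μ • 1 with hW
    set β : E → ℝ := fun e =>
      (y e - primitive (G.len e) (primitive (G.len e) (W e)) (G.len e)) / G.len e with hβ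
    have hr : ∑ v, (k v -
        G.normalDerivSum (fun e s => β e + primitive (G.len e) (W e) s) v) = 0 := by
      have h1 := sum_mul_normalDerivSum (G := G) (fun _ => 1)
        (fun e s => β e + primitive (G.len e) (W e) s)
      simp only [one_mul] at h1
      rw [Finset.sum_sub_distrib, h1]
      have h2 : ∀ e, β e + primitive (G.len e) (W e) (G.len e) -
          (β e + primitive (G.len e) (W e) 0) =
          primitive (G.len e) (x e + t • Q e) (G.len e) - μ * G.len e := by
        intro e
        have : W e = (x e + t • Q e) - μ • 1 := rfl
        rw [primitive_zero (hlen e), this, map_sub, map_smul]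
        simp [primitive_one (len_mem e)]
      rw [Finset.sum_congr rfl fun e _ => h2 e, Finset.sum_sub_distrib, ← Finset.mul_sum, hμ,
        div_mul_cancel₀ _ hlenpos.ne']
      ring
    obtain ⟨B, hB⟩ := hG.exists_normalDerivSum_eq hr
    refine ⟨(W, B, fun e => (B (G.tgt e) - B (G.src e)) / G.len e + β e, μ, t), ?_⟩
    refine Prod.ext ?_ (Prod.ext ?_ (Prod.ext ?_ rfl))
    · change W - (t • Q - μ • 1) = x
      rw [hW]
      abel
    · funext e
      change N _ e = y e
      rw [hN, hR, primitive_one (len_mem e)]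
      change B (G.src e) + ((B (G.tgt e) - B (G.src e)) / G.len e + β e) * G.len e +
        primitive (G.len e) (primitive (G.len e) (W e)) (G.len e) - B (G.tgt e) = y e
      have := (G.len_pos e).ne'
      simp only [hβ]
      field_simp
      ring
    · funext v
      change K _ v = k v
      rw [hK]
      simp only [hD]
      change G.normalDerivSum (fun e s => ((B (G.tgt e) - B (G.src e)) / G.len e + β e) +
        primitive (G.len e) (W e) s) v = k v
      simp only [add_assoc]
      rw [normalDerivSum_add (fun e _ => (B (G.tgt e) - B (G.src e)) / G.len e), hB]
      ring
  -- A surjective strict derivative makes `Φ` open at `z₀`, so points `(0, 0, 0, t)` with small `t >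
  -- 0` are values of `Φ` near `z₀`, where `‖R z - 1‖ < 1` ensures positivity.
  have hmap := hderiv.map_nhds_eq_of_surj (LinearMap.range_eq_top.mpr hsurj)
  rw [hΦ₀] at hmap
  have hU : ∀ᶠ z in 𝓝 z₀, ‖R z - 1‖ < 1 ∧ m z < ε := by
    have h1 : Tendsto (fun z => ‖R z - 1‖) (𝓝 z₀) (𝓝 0) := by
      have : Continuous fun z => ‖R z - 1‖ := by fun_prop
      have := this.tendsto z₀
      rwa [hR₀, sub_self, norm_zero] at this
    have h2 : Tendsto m (𝓝 z₀) (𝓝 0) := m.continuous.tendsto z₀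
    exact (h1.eventually_lt_const one_pos).and (h2.eventually_lt_const hε)
  have himage := hmap ▸ image_mem_map hU
  have hcurve : Tendsto (fun t : ℝ => ((0, 0, 0, t) : (E → ℝ →ᵇ ℝ) × (E → ℝ) × (V → ℝ) × ℝ))
      (𝓝[>] 0) (𝓝 0) := by
    have : Continuous (fun t : ℝ => ((0, 0, 0, t) : (E → ℝ →ᵇ ℝ) × (E → ℝ) × (V → ℝ) × ℝ)) := by
      fun_prop
    exact (this.tendsto 0).mono_left nhdsWithin_le_nhds
  obtain ⟨t, ⟨z, ⟨hz1, hz2⟩, hz⟩, ht⟩ :=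
    ((hcurve.eventually himage).and (Ioo_mem_nhdsGT hε)).exists
  simp only [Φ, Prod.mk.injEq] at hz
  obtain ⟨e1, e2, e3, e4⟩ := hz
  have hw : ∀ e, ∀ s ∈ Icc 0 (G.len e), w z e s = (t * q (G.pt e s) - m z) * R z e s := by
    intro e s hs
    have := congrArg (fun f : E → ℝ →ᵇ ℝ => f e s) (sub_eq_zero.mp e1)
    simpa [S, e4, Q, clamp_of_mem hs] using this
  have hglue : ∀ e, ∀ s ∈ Icc 0 (G.len e),
      glue (b z) (fun e s => R z e s) (G.pt e s) = R z e s := by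
    intro e s hs
    refine glue_pt ?_ ?_ hs
    · simp [hR, primitive_zero (hlen e)]
    · have := congrFun e2 e
      rw [hN] at this
      exact sub_eq_zero.mp this
  refine ⟨t, ht, m z, hz2, glue (b z) (fun e s => R z e s), fun e s => D z e s, fun x => ?_,
    continuous_of_continuousOn_edges fun e => ?_, fun e => (D z e).continuous.continuousOn,
    fun e s hs => ?_, fun e s hs => ?_, fun v => ?_⟩
  · obtain ⟨e, s, hs, rfl⟩ := exists_pt_eq x
    rw [hglue e s hs]
    have h1 : |R z e s - 1| < 1 :=
      (((R z - 1) e).norm_coe_le_norm s).trans_lt ((norm_le_pi_norm (R z - 1) e).trans_lt hz1)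
    linarith [(abs_lt.mp h1).1]
  · exact (R z e).continuous.continuousOn.congr (hglue e)
  · have h1 : HasDerivAt (R z e) (D z e s) s := by
      have : ⇑(R z e) = fun s => b z (G.src e) + d z e * primitive (G.len e) 1 s +
          primitive (G.len e) (primitive (G.len e) (w z e)) s := funext (hR z e)
      rw [this, hD]
      refine ((((hasDerivAt_primitive 1 hs).const_mul (d z e)).const_add _).add
        (hasDerivAt_primitive _ hs)).congr_deriv ?_
      simp
    refine h1.congr_of_eventuallyEq ?_
    filter_upwards [Icc_mem_nhds hs.1 hs.2] with r hr using hglue e r hr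
  · have hs' := Ioo_subset_Icc_self hs
    have : (fun s => D z e s) = fun s => d z e + primitive (G.len e) (w z e) s := funext (hD z e)
    rw [hglue e s hs', ← hw e s hs', this]
    exact (hasDerivAt_primitive _ hs).const_add _
  · rw [← hK, e3, Pi.zero_apply]

/-! ### The gap -/

section

variable [Fintype E] {q : G.Point → ℝ} {μ : ℝ} {φ : G.Point → ℝ} {dφ : E → ℝ → ℝ}

theorem IsSolution.mem_lowerBounds (hφ : G.IsSolution q μ φ dφ) (hpos : ∀ x, 0 < φ x)
    (hq : Continuous q) {k : ℕ} (hk : 0 < k) :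
    μ ∈ lowerBounds {μ : ℝ | ∃ u : Fin k → G.Point → ℝ, LinearIndependent ℝ u ∧
      ∀ i, ∃ ν ≤ μ, G.IsEigenfunction q ν (u i)} := by
  rintro η ⟨u, -, hu⟩
  obtain ⟨ν, hν, heig⟩ := hu ⟨0, hk⟩
  obtain ⟨du, hdu⟩ := heig.exists_isSolution hq
  exact (hφ.le_of_pos hpos hdu heig.1).trans hν

theorem IsSolution.eigenvalue_one_eq [Nonempty V] (hφ : G.IsSolution q μ φ dφ)
    (hpos : ∀ x, 0 < φ x) (hq : Continuous q) : G.eigenvalue q 1 = μ := by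
  have hne : φ ≠ 0 := fun h =>
    (hpos (.vertex (Classical.arbitrary V))).ne' (by rw [h, Pi.zero_apply])
  refine IsLeast.csInf_eq ⟨⟨fun _ => φ, ?_, fun _ => ⟨μ, le_rfl, hφ.isEigenfunction hq hne⟩⟩,
    hφ.mem_lowerBounds hpos hq one_pos⟩
  exact linearIndependent_unique_iff.mpr hne

/-- A zero of `u` makes it independent of the positive `φ`, so the pair is admissible in the
infimum. -/
theorem IsSolution.eigenvalue_two_le {lam : ℝ} {u : G.Point → ℝ} {x : G.Point}
    (hφ : G.IsSolution q μ φ dφ) (hpos : ∀ x, 0 < φ x) (hq : Continuous q) (hlam : μ ≤ lam)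
    (hu : G.IsEigenfunction q lam u) (hx : u x = 0) : G.eigenvalue q 2 ≤ lam := by
  refine csInf_le ⟨μ, hφ.mem_lowerBounds hpos hq two_pos⟩ ⟨![φ, u], ?_, ?_⟩
  · rw [LinearIndependent.pair_iff]
    intro a b hab
    have ha : a = 0 := by
      have := congrFun hab x
      simpa [hx, (hpos x).ne'] using this
    refine ⟨ha, ?_⟩
    rw [ha, zero_smul, zero_add] at hab
    exact (smul_eq_zero.mp hab).resolve_right hu.1
  · have hne : φ ≠ 0 := fun h => (hpos x).ne' (by rw [h, Pi.zero_apply])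
    intro i
    fin_cases i
    · exact ⟨μ, hlam, hφ.isEigenfunction hq hne⟩
    · exact ⟨lam, le_rfl, hu⟩

end

end MetricGraph

end

theorem mainTheorem6 {V E : Type*} [Fintype E] (G : MetricGraph V E) (hG : G.IsTree)
    (hvanish : ∃ u : G.Point → ℝ, G.IsEigenfunction 0 (G.eigenvalue 0 2) u ∧
      ∃ e : E, ∀ s ∈ Set.Icc (0 : ℝ) (G.len e), u (G.pt e s) = 0)
    (M : ℝ) (hM : 0 < M) :
    ¬ IsMinOn G.gap (G.convexClass M) 0 := by
  obtain ⟨u₀, hu₀, f, hf⟩ := hvanish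
  have : Nonempty V := hG.2.2.connected.nonempty
  set lam := G.eigenvalue 0 2 with hlam
  obtain ⟨du₀, hdu₀⟩ := hu₀.exists_isSolution continuous_const
  -- Eigenfunctions for eigenvalue `0` are constant, and one that vanishes on an edge would be zero.
  have hlam0 : 0 < lam := by
    refine lt_of_le_of_ne (MetricGraph.isSolution_one.le_of_pos (fun _ => one_pos) hdu₀ hu₀.1) fun h => ?_
    rw [← h] at hdu₀
    exact hu₀.1 (funext fun x => (hdu₀.eq_of_zero hG x (G.pt f 0)).trans (hf 0 (MetricGraph.zero_mem f)))
  obtain ⟨w, e, u, du, he, hu, hu0, hue⟩ := hG.exists_isSolution_boundaryEdge hdu₀ hu₀.1 hf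
  have hbound : ∀ x, |G.boundaryPotential w e 1 x| ≤ 1 := fun x => by
    have := he.boundaryPotential_mem_Icc zero_le_one x
    rw [abs_of_nonneg this.1]
    exact this.2
  -- The bound by `M` keeps the potential in the class; the bound by `lam` keeps `μ` below the
  -- eigenvalue of `u`.
  obtain ⟨t, ht, μ, hμ, φ, dφ, hpos, hφ⟩ := hG.exists_pos_isSolution
    (he.continuous_boundaryPotential 1) hbound (lt_min hM hlam0)
  have hqt : (fun x => t * G.boundaryPotential w e 1 x) = G.boundaryPotential w e t := by
    funext x
    simp [MetricGraph.boundaryPotential]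
  rw [hqt] at hφ
  rw [lt_min_iff] at hμ
  have hcont := he.continuous_boundaryPotential t
  have hmem := he.boundaryPotential_mem_convexClass hG.1 ht.1.le (ht.2.trans_le (min_le_left _ _)).le
  have hhalf : G.len e / 2 ∈ Set.Ioo 0 (G.len e) :=
    ⟨half_pos (G.len_pos e), half_lt_self (G.len_pos e)⟩
  have hμ0 : 0 < μ := hφ.eigenvalue_pos hpos (fun x => (he.boundaryPotential_mem_Icc ht.1.le x).1)
    hhalf (he.boundaryPotential_pt_pos ht.1 hhalf)
  -- The potential is zero off `e` and `u` is zero on `e`, so their product vanishes.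
  have hu' : G.IsSolution (G.boundaryPotential w e t) lam u du := by
    refine ⟨hu.continuous, hu.continuousOn_deriv, hu.hasDerivAt, fun e' s hs => ?_, hu.kirchhoff⟩
    have hs' := Set.Ioo_subset_Icc_self hs
    refine (hu.hasDerivAt_deriv e' s hs).congr_deriv ?_
    by_cases h : e' = e
    · subst h
      rw [hue s hs', mul_zero, mul_zero]
    · rw [he.boundaryPotential_pt_of_ne h t hs', Pi.zero_apply]
  have h2 := hφ.eigenvalue_two_le hpos hcont hμ.2.le (hu'.isEigenfunction hcont hu0)
    (hue 0 (MetricGraph.zero_mem e))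
  have h1 := hφ.eigenvalue_one_eq hpos hcont
  have h3 : G.eigenvalue 0 1 = 0 := MetricGraph.isSolution_one.eigenvalue_one_eq (fun _ => one_pos)
    continuous_const
  intro hmin
  -- Minimality would give `lam ≤ lam - μ`, contradicting `μ > 0`.
  have := isMinOn_iff.mp hmin _ hmem
  rw [MetricGraph.gap, MetricGraph.gap, h1, h3] at this
  linarith
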